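/- Let $d\ge 1$ be an integer, $\beta\ge 0$ and $h$ real, $\beta_c=\frac1{2d}$, and for $n\ge 1$ let \[Z_{d,\beta,h}=Z_{d,\beta,h}(n):=\sum_{\sigma\in\{-1,1\}^n}\exp\Big\{\frac{d\beta}{n}\Big(\sum_{j=1}^n\sigma_j\Big)^2+h\sum_{j=1}^n\sigma_j\Big\}.\] For $\beta>0$ put $\varphi(t)=\ln\cosh t-\frac{(t-|h|)^2}{4d\beta}$. For a sequence $c$ and integers $k,N\ge1$ write $S_{k,N}[c]=\sum_{m_1,\dots,m_k\ge 1,\ m_1+\cdots+m_k=N}c_{m_1}c_{m_2}\cdots c_{m_k}$. The following hold as $n\to\infty$, with all coefficients independent of $n$ and $M$. (1) If $h=0$ and $\beta<\beta_c$, then for every $M\ge1$, \[Z_{d,\beta,0}=2^n\Big(\sum_{p=0}^M e_p^{<}n^{-p}+o(n^{-M})\Big),\] where $e_0^{<}=(1-2d\beta)^{-1/2}$ and, for $p\ge 1$, \[e_p^{<}=\sum_{k=1}^p\frac{(2p+2k-1)!!}{k!}(2d\beta)^{p+k}(1-2d\beta)^{-\frac{2p+2k+1}2}\,S_{k,p}\big[(a_{2(m+1)})_{m\ge1}\big],\]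 $a_q$ being the coefficient of $t^q$ in the Taylor expansion of $\varphi$ at $0$ (only $q\ge4$ occurs, where it is also that of $\ln\cosh t$, which is the meaning of $a_q$ if $\beta=0$). (2) If $h=0$ and $\beta=\beta_c$, then for every $M\ge1$, \[Z_{d,\beta,0}=2^n\Big(\sum_{p=0}^M e_p^{c}n^{-p/2+1/4}+o(n^{-M/2+1/4})\Big),\] where $e_0^c=\frac1{\sqrt{2\pi}}\left(\frac34\right)^{1/4}\Gamma(\frac14)$ and, for $p\ge1$, \[e_p^c=\frac1{\sqrt{2\pi}}\Big(\frac34\Big)^{1/4}\sum_{k=1}^p\frac{12^{\frac p2+k}\,\Gamma(\frac p2+k+\frac14)}{k!}\,S_{k,p}\big[(a_{2m+4})_{m\ge1}\big],\] $a_q$ being the coefficient of $t^q$ in the Taylor expansion of $\varphi(t)=\ln\cosh t-\frac{t^2}{2}$ at $0$. (3) If $h=0$ and $\beta>\beta_c$, the equation $\tanh\big(\frac{\beta}{\beta_c}z\big)=z$ has a maximal real solution $z_*$, and $z_*>0$. Define $t_*$ by $z_*=\frac{t_*}{2d\beta}$. Then for every $M\ge1$, \[Z_{d,\beta,0}=2^ne^{n\varphi(t_*)}\Big(\sum_{p=0}^M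 e_p^{>}n^{-p}+o(n^{-M})\Big),\] where $\varphi(t_*)=\ln\cosh t_*-\frac{t_*^2}{4d\beta}$, $e_0^{>}=2^{1/2}(d\beta)^{-1/2}\big(\frac1{2d\beta}-\frac1{\cosh^2t_*}\big)^{-1/2}$ and, for $p\ge1$, \[e_p^{>}=(-d\beta a_2)^{-1/2}\sum_{k=1}^{2p}\frac{(2p+2k-1)!!}{k!}(-2a_2)^{-(p+k)}\,S_{k,2p}\big[(a_{m+2})_{m\ge1}\big],\] $a_q$ being the coefficient of $(t-t_*)^q$ in the Taylor expansion of $\varphi$ at $t_*$. (4) If $h\ne0$ and $\beta>0$, the equation $\tanh\big(\frac{\beta}{\beta_c}z+|h|\big)=z$ has a maximal real solution $z_*$, and $z_*>0$. Define $t_*$ by $z_*=\frac{t_*-|h|}{2d\beta}$. Then for every $M\ge1$, \[Z_{d,\beta,h}=2^ne^{n\varphi(t_*)}\Big(\sum_{p=0}^M e_p^{h\ne0}n^{-p}+o(n^{-M})\Big),\] where $\varphi(t_*)=\ln\cosh t_*-\frac{(t_*-|h|)^2}{4d\beta}$, $e_0^{h\ne0}=(2d\beta)^{-1/2}\big(\frac1{2d\beta}-\frac1{\cosh^2t_*}\big)^{-1/2}$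 and, for $p\ge1$, \[e_p^{h\ne0}=(-4d\beta a_2)^{-1/2}\sum_{k=1}^{2p}\frac{(2p+2k-1)!!}{k!}(-2a_2)^{-(p+k)}\,S_{k,2p}\big[(a_{m+2})_{m\ge1}\big],\] $a_q$ being the coefficient of $(t-t_*)^q$ in the Taylor expansion of $\varphi$ at $t_*$. If $h\neq0$ and $\beta=0$ (where these formulas divide by zero), then exactly $Z_{d,0,h}=2^ne^{n\ln\cosh|h|}$ for all $n\ge1$. -/

import Mathlib

open Asymptotics Filter
open scoped Nat

noncomputable section

namespace CurieWeiss

/-- The Curie-Weiss partition function on `n` spins, a sum over `{-1, 1}ⁿ`. -/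
def Z (d : ℕ) (β h : ℝ) (n : ℕ) : ℝ :=
  ∑ σ ∈ Fintype.piFinset (fun _ : Fin n => ({-1, 1} : Finset ℝ)),
    Real.exp (d * β / n * (∑ j, σ j) ^ 2 + h * ∑ j, σ j)

/-- The critical inverse temperature. -/
def betaC (d : ℕ) : ℝ := 1 / (2 * d)

/-- `φ(t) = ln cosh t - (t - |h|)² / (4dβ)`. For `β = 0` the quotient is `0` in Lean; this is used
only through the Taylor coefficients of order at least `4`, which do not involve the quadratic
term. -/
def phi (d : ℕ) (β h t : ℝ) : ℝ :=
  Real.log (Real.cosh t) - (t - |h|) ^ 2 / (4 * d * β)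

/-- The `p`-th Taylor coefficient of `φ` at the point `t`. -/
def a (d : ℕ) (β h t : ℝ) (p : ℕ) : ℝ :=
  iteratedDeriv p (phi d β h) t / p !

/-- `∑ c(m₁) c(m₂) ⋯ c(mₖ)` over all `k`-tuples of integers `mᵢ ≥ 1` with
`m₁ + ⋯ + mₖ = N`. -/
def compSum (c : ℕ → ℝ) (k N : ℕ) : ℝ :=
  ∑ m ∈ (Finset.Nat.antidiagonalTuple k N).filter (fun m => ∀ i, 1 ≤ m i), ∏ i, c (m i)

/-- Coefficients at high temperature (`h = 0`, `β < β_c`). -/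
def eHigh (d : ℕ) (β : ℝ) (p : ℕ) : ℝ :=
  if p = 0 then (1 - 2 * d * β) ^ (-(1 / 2) : ℝ)
  else ∑ k ∈ Finset.Icc 1 p,
    ((2 * p + 2 * k - 1)‼ : ℝ) * (2 * d * β) ^ (p + k)
      * (1 - 2 * d * β) ^ (-((2 * p + 2 * k + 1) / 2) : ℝ) / k !
      * compSum (fun m => a d β 0 0 (2 * (m + 1))) k p

/-- Coefficients at criticality (`h = 0`, `β = β_c`). -/
def eCrit (d : ℕ) (p : ℕ) : ℝ :=
  if p = 0 then 1 / √(2 * Real.pi) * (3 / 4 : ℝ) ^ (1 / 4 : ℝ) * Real.Gamma (1 / 4)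
  else 1 / √(2 * Real.pi) * (3 / 4 : ℝ) ^ (1 / 4 : ℝ) * ∑ k ∈ Finset.Icc 1 p,
    (12 : ℝ) ^ ((p : ℝ) / 2 + k) * Real.Gamma ((p : ℝ) / 2 + k + 1 / 4) / k !
      * compSum (fun m => a d (betaC d) 0 0 (2 * m + 4)) k p

/-- Coefficients at low temperature (`h = 0`, `β > β_c`), where `t` is the maximum point `t_*`. -/
def eLow (d : ℕ) (β t : ℝ) (p : ℕ) : ℝ :=
  if p = 0 then
    (2 : ℝ) ^ (1 / 2 : ℝ) * (d * β) ^ (-(1 / 2) : ℝ)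
      * (1 / (2 * d * β) - 1 / Real.cosh t ^ 2) ^ (-(1 / 2) : ℝ)
  else (-(d * β * a d β 0 t 2)) ^ (-(1 / 2) : ℝ) * ∑ k ∈ Finset.Icc 1 (2 * p),
    ((2 * p + 2 * k - 1)‼ : ℝ) / k ! * (-2 * a d β 0 t 2) ^ (-((p : ℤ) + k))
      * compSum (fun m => a d β 0 t (m + 2)) k (2 * p)

/-- Coefficients for nonzero field (`h ≠ 0`, `β > 0`), where `t` is the maximum point `t_*`. -/
def eField (d : ℕ) (β h t : ℝ) (p : ℕ) : ℝ :=
  if p = 0 then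
    (2 * d * β) ^ (-(1 / 2) : ℝ)
      * (1 / (2 * d * β) - 1 / Real.cosh t ^ 2) ^ (-(1 / 2) : ℝ)
  else (-(4 * d * β * a d β h t 2)) ^ (-(1 / 2) : ℝ) * ∑ k ∈ Finset.Icc 1 (2 * p),
    ((2 * p + 2 * k - 1)‼ : ℝ) / k ! * (-2 * a d β h t 2) ^ (-((p : ℤ) + k))
      * compSum (fun m => a d β h t (m + 2)) k (2 * p)

end CurieWeiss

end

/-!
Expansion of the Curie–Weiss partition function in powers of the number of spins.

For `β = 0` the spins are independent and `Z` is explicit. For `β > 0`, the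
Hubbard–Stratonovich transformation (`CurieWeiss.Z_eq_integral`) turns `Z` into
`2 ^ n * √(n / (4πdβ)) * ∫ exp (n φ)`, so everything follows from Laplace's method at the global
maximum points of `φ`. There is one such point (`0` if `h = 0` and `β ≤ β_c`, and `t_* > 0` if
`h ≠ 0`) or a symmetric pair `±t_*` (if `h = 0` and `β > β_c`); in the latter case `Z` is twice the
integral over the positive half-line. The point `t_*` is the positive zero of `φ'`, which is
strictly concave on `[0, ∞)` (`CurieWeiss.exists_maximum_point`).

`CurieWeiss.laplace_expansion` treats an exponent `n x ^ (2ν) (-c + u x)` with `u 0 = 0`; the case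
`ν = 1` is a nondegenerate maximum and `ν = 2` is the critical one, where `φ` has vanishing second
derivative. Put `s = n x ^ (2ν)`. For `s` regarded as an independent parameter, `exp (s u x)` has a
Taylor expansion in `x` with coefficients `∑ k, S_{k,N} s ^ k / k!`, where `S_{k,N}` is the `N`-th
Taylor coefficient of `u ^ k`, that is, a composition sum. For `x` near `0` the error is
at most a constant times `|x| ^ (K + 1) (1 + s) ^ (K + 1) exp (c s / 2)`, and the integrand carries
a further factor `exp (-c s)`. The same estimate is made global instead of
cutting the integral: away from the maximum, `1 ≤ (|x| / δ) ^ (K + 1)`, so the tails are absorbed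
in errors of the same form, namely `|x| ^ (K + 1)` times a polynomial in `s` times
`exp (-c s / 2)`, plus `|x| ^ (K + 1) exp (-L n x ^ 2)`. All integrals are then explicit moments,
given by the Gamma function, and scaling in `n` yields both the coefficients and the order of the
remainder. Odd moments vanish, which is why only every other order survives.
-/

namespace CurieWeiss

open Topology MeasureTheory

/-! ### Composition sums as Taylor coefficients of powers -/

theorem compSum_eq_sum_antidiagonalTuple (c : ℕ → ℝ) (k N : ℕ) :
    compSum c k N =
      ∑ m ∈ Finset.Nat.antidiagonalTuple k N, ∏ i, if m i = 0 then 0 else c (m i) := by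
  rw [compSum, Finset.sum_filter]
  refine Finset.sum_congr rfl fun m _ => ?_
  split_ifs with h
  · refine Finset.prod_congr rfl fun i _ => ?_
    rw [if_neg (by have := h i; omega)]
  · push Not at h
    obtain ⟨i, hi⟩ := h
    exact (Finset.prod_eq_zero (Finset.mem_univ i) (by rw [if_pos (by omega)])).symm

theorem compSum_zero (c : ℕ → ℝ) (N : ℕ) : compSum c 0 N = if N = 0 then 1 else 0 := by
  rw [compSum_eq_sum_antidiagonalTuple]
  cases N <;> simp

theorem compSum_succ (c : ℕ → ℝ) (k N : ℕ) :
    compSum c (k + 1) N =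
      ∑ ij ∈ Finset.HasAntidiagonal.antidiagonal N,
        (if ij.1 = 0 then 0 else c ij.1) * compSum c k ij.2 := by
  simp only [compSum_eq_sum_antidiagonalTuple, Finset.mul_sum]
  rw [Finset.sum_sigma']
  symm
  refine Finset.sum_bij' (fun x _ => (Fin.cons x.1.1 x.2 : Fin (k + 1) → ℕ))
    (fun m _ => ⟨(m 0, ∑ i, Fin.tail m i), Fin.tail m⟩) ?_ ?_ ?_ ?_ ?_
  · rintro ⟨⟨i, j⟩, m⟩ h
    simp only [Finset.mem_sigma, Finset.HasAntidiagonal.mem_antidiagonal,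
      Finset.Nat.mem_antidiagonalTuple] at h ⊢
    rw [Fin.sum_univ_succ]
    simp [h.2, h.1]
  · intro m h
    simp only [Finset.mem_sigma, Finset.HasAntidiagonal.mem_antidiagonal,
      Finset.Nat.mem_antidiagonalTuple] at h ⊢
    rw [Fin.sum_univ_succ] at h
    exact ⟨h, trivial⟩
  · rintro ⟨⟨i, j⟩, m⟩ h
    simp only [Finset.mem_sigma, Finset.HasAntidiagonal.mem_antidiagonal,
      Finset.Nat.mem_antidiagonalTuple] at h
    simp [h.2]
  · intro m h
    simp
  · rintro ⟨⟨i, j⟩, m⟩ h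
    rw [Fin.prod_univ_succ]
    simp

theorem compSum_eq_zero_of_lt (c : ℕ → ℝ) {k N : ℕ} (h : N < k) : compSum c k N = 0 := by
  induction k generalizing N with
  | zero => omega
  | succ k ih =>
    rw [compSum_succ]
    refine Finset.sum_eq_zero fun ij hij => ?_
    rw [Finset.HasAntidiagonal.mem_antidiagonal] at hij
    split_ifs with h0
    · simp
    · rw [ih (by omega), mul_zero]

theorem sum_antidiagonal_two_mul (f : ℕ × ℕ → ℝ) (hf : ∀ ij, Odd ij.1 → f ij = 0) (p : ℕ) :
    ∑ ij ∈ Finset.HasAntidiagonal.antidiagonal (2 * p), f ij =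
      ∑ ij ∈ Finset.HasAntidiagonal.antidiagonal p, f (2 * ij.1, 2 * ij.2) := by
  symm
  refine Finset.sum_of_injOn (fun ij => (2 * ij.1, 2 * ij.2)) ?_ ?_ ?_ ?_
  · rintro ⟨i, j⟩ _ ⟨i', j'⟩ _ h
    simp only [Prod.mk.injEq] at h ⊢
    omega
  · rintro ⟨i, j⟩ h
    simp only [Finset.mem_coe, Finset.HasAntidiagonal.mem_antidiagonal] at h ⊢
    omega
  · rintro ⟨i, j⟩ h h'
    refine hf _ ?_
    by_contra ho
    rw [Nat.not_odd_iff_even] at ho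
    obtain ⟨r, hr⟩ := ho
    simp only [Finset.HasAntidiagonal.mem_antidiagonal] at h hr
    refine h' ⟨(r, p - r), ?_, ?_⟩
    · simp only [Finset.mem_coe, Finset.HasAntidiagonal.mem_antidiagonal]; omega
    · simp only [Prod.mk.injEq]; omega
  · intro _ _; rfl

/-- Only tuples of even indices contribute when the odd entries of the sequence vanish. -/
theorem compSum_two_mul {c : ℕ → ℝ} (hc : ∀ m, Odd m → c m = 0) (k p : ℕ) :
    compSum c k (2 * p) = compSum (fun m => c (2 * m)) k p := by
  induction k generalizing p with
  | zero => simp [compSum_zero]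
  | succ k ih =>
    rw [compSum_succ, compSum_succ, sum_antidiagonal_two_mul]
    · refine Finset.sum_congr rfl fun ij _ => ?_
      rw [ih]; simp
    · intro ij h
      rw [hc _ h]; simp

/-- The composition sums are the coefficients of the powers of a polynomial without constant
term. -/
theorem coeff_pow_eq_compSum {P : Polynomial ℝ} {b : ℕ → ℝ} {K : ℕ}
    (hP : ∀ m ≤ K, P.coeff m = if m = 0 then 0 else b m) (k : ℕ) {N : ℕ} (hN : N ≤ K) :
    (P ^ k).coeff N = compSum b k N := by
  induction k generalizing N with
  | zero => rw [compSum_zero, pow_zero, Polynomial.coeff_one]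
  | succ k ih =>
    rw [pow_succ', Polynomial.coeff_mul, compSum_succ]
    refine Finset.sum_congr rfl fun ij hij => ?_
    rw [Finset.HasAntidiagonal.mem_antidiagonal] at hij
    rw [hP _ (by omega), ih (by omega)]

theorem eval_isBigO_of_coeff_eq_zero {R : Polynomial ℝ} {K : ℕ} (hR : ∀ m ≤ K, R.coeff m = 0) :
    (fun x : ℝ => R.eval x) =O[𝓝 0] fun x => x ^ (K + 1) := by
  obtain ⟨Q, rfl⟩ := Polynomial.X_pow_dvd_iff.mpr fun m (hm : m < K + 1) => hR m (by omega)
  simp only [Polynomial.eval_mul, Polynomial.eval_pow, Polynomial.eval_X]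
  simpa using (isBigO_refl (fun x : ℝ => x ^ (K + 1)) (𝓝 0)).mul
    ((Q.continuous.tendsto 0).isBigO_one ℝ)

/-- If `u` has the finite Taylor expansion `b₁ x + ⋯ + b_K x ^ K` at `0`, then the Taylor
coefficients of `u ^ k` up to order `K` are the composition sums of `b`. -/
theorem pow_sub_sum_isBigO {u : ℝ → ℝ} {b : ℕ → ℝ} {K : ℕ}
    (hu : (fun x => u x - ∑ m ∈ Finset.range (K + 1), (if m = 0 then 0 else b m) * x ^ m)
      =O[𝓝 0] fun x : ℝ => x ^ (K + 1)) (k : ℕ) :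
    (fun x => u x ^ k - ∑ N ∈ Finset.range (K + 1), compSum b k N * x ^ N)
      =O[𝓝 0] fun x : ℝ => x ^ (K + 1) := by
  set P : Polynomial ℝ :=
    ∑ m ∈ Finset.range (K + 1), Polynomial.C (if m = 0 then 0 else b m) * Polynomial.X ^ m with hPd
  have hcoef : ∀ (f : ℕ → ℝ), ∀ m ≤ K,
      (∑ m ∈ Finset.range (K + 1), Polynomial.C (f m) * Polynomial.X ^ m).coeff m = f m := by
    intro f m hm
    rw [Polynomial.finsetSum_coeff]
    simp only [Polynomial.coeff_C_mul_X_pow]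
    rw [Finset.sum_ite_eq, if_pos (by simp; omega)]
  have hPe : ∀ x, P.eval x = ∑ m ∈ Finset.range (K + 1), (if m = 0 then 0 else b m) * x ^ m := by
    intro x
    rw [hPd, Polynomial.eval_finsetSum]
    exact Finset.sum_congr rfl fun m _ => by simp
  simp only [← hPe] at hu
  have hxK : (fun x : ℝ => x ^ (K + 1)) =O[𝓝 0] (fun _ => (1 : ℝ)) :=
    ((continuous_pow (K + 1)).tendsto 0).isBigO_one ℝ
  have hP1 : ∀ Q : Polynomial ℝ, (fun x => Q.eval x) =O[𝓝 0] (fun _ => (1 : ℝ)) := fun Q =>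
    (Q.continuous.tendsto 0).isBigO_one ℝ
  have hu1 : u =O[𝓝 0] (fun _ => (1 : ℝ)) := by
    simpa using (hu.trans hxK).add (hP1 P)
  have hpow : ∀ k : ℕ, (fun x => u x ^ k - (P ^ k).eval x) =O[𝓝 0] fun x : ℝ => x ^ (K + 1) := by
    intro k
    induction k with
    | zero => simpa using isBigO_zero _ _
    | succ k ih =>
      have h1 := hu1.mul ih
      have h2 := hu.mul (hP1 (P ^ k))
      simp only [one_mul, mul_one] at h1 h2
      refine (h1.add h2).congr_left fun x => ?_
      simp only [pow_succ', Polynomial.eval_mul]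
      ring
  have h3 := eval_isBigO_of_coeff_eq_zero (K := K) (R := P ^ k -
    ∑ N ∈ Finset.range (K + 1), Polynomial.C (compSum b k N) * Polynomial.X ^ N) (by
      intro m hm
      rw [Polynomial.coeff_sub, hcoef _ m hm,
        coeff_pow_eq_compSum (fun m hm => hcoef (fun m => if m = 0 then 0 else b m) m hm) k hm,
        sub_self])
  refine ((hpow k).add h3).congr_left fun x => ?_
  rw [Polynomial.eval_sub, Polynomial.eval_finsetSum]
  simp

/-! ### Moments and Laplace's method -/

/-- The value of `∫ |x| ^ q * exp (-b * x ^ (2ν))` over the real line, for `b > 0`. -/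
noncomputable def moment (ν q : ℕ) (b : ℝ) : ℝ :=
  b ^ (-(((q : ℝ) + 1) / (2 * ν))) * (1 / ν) * Real.Gamma (((q : ℝ) + 1) / (2 * ν))

theorem moment_pos {ν : ℕ} (hν : 1 ≤ ν) (q : ℕ) {b : ℝ} (hb : 0 < b) : 0 < moment ν q b := by
  have hν' : (0 : ℝ) < ν := by exact_mod_cast hν
  have := Real.Gamma_pos_of_pos (s := ((q : ℝ) + 1) / (2 * ν)) (by positivity)
  unfold moment
  positivity

theorem integral_abs_pow_mul_exp {ν : ℕ} (hν : 1 ≤ ν) (q : ℕ) {b : ℝ} (hb : 0 < b) :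
    ∫ x : ℝ, |x| ^ q * Real.exp (-b * x ^ (2 * ν)) = moment ν q b := by
  have hν' : (0 : ℝ) < ν := by exact_mod_cast hν
  have h1 : ∀ x : ℝ, |x| ^ q * Real.exp (-b * x ^ (2 * ν)) =
      (fun r : ℝ => r ^ (q : ℝ) * Real.exp (-b * r ^ (2 * ν : ℝ))) |x| := by
    intro x
    have h2 : (2 * ν : ℝ) = ((2 * ν : ℕ) : ℝ) := by push_cast; ring
    simp only [h2, Real.rpow_natCast]
    rw [pow_mul, pow_mul, sq_abs]
  rw [integral_congr_ae (ae_of_all _ h1),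
    integral_comp_abs (f := fun r : ℝ => r ^ (q : ℝ) * Real.exp (-b * r ^ (2 * ν : ℝ))),
    integral_rpow_mul_exp_neg_mul_rpow (by positivity)
    (by have : (0 : ℝ) ≤ q := Nat.cast_nonneg q
        linarith) hb, moment, neg_div]
  field_simp

theorem integrable_abs_pow_mul_exp {ν : ℕ} (hν : 1 ≤ ν) (q : ℕ) {b : ℝ} (hb : 0 < b) :
    Integrable fun x : ℝ => |x| ^ q * Real.exp (-b * x ^ (2 * ν)) := by
  -- A non-integrable function has integral `0`, whereas this integral is positive.
  by_contra h
  have h1 := integral_abs_pow_mul_exp hν q hb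
  rw [integral_undef h] at h1
  exact (moment_pos hν q hb).ne h1

theorem integrable_pow_mul_exp {ν : ℕ} (hν : 1 ≤ ν) (q : ℕ) {b : ℝ} (hb : 0 < b) :
    Integrable fun x : ℝ => x ^ q * Real.exp (-b * x ^ (2 * ν)) := by
  refine (integrable_abs_pow_mul_exp hν q hb).mono' (by fun_prop) (ae_of_all _ fun x => ?_)
  rw [norm_mul, norm_pow, Real.norm_eq_abs, Real.norm_eq_abs, Real.abs_exp]

theorem integral_pow_mul_exp {ν : ℕ} (hν : 1 ≤ ν) (q : ℕ) {b : ℝ} (hb : 0 < b) :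
    ∫ x : ℝ, x ^ q * Real.exp (-b * x ^ (2 * ν)) = if Even q then moment ν q b else 0 := by
  split_ifs with hq
  · rw [← integral_abs_pow_mul_exp hν q hb]
    simp_rw [hq.pow_abs]
  · have h := integral_neg_eq_self (fun x : ℝ => x ^ q * Real.exp (-b * x ^ (2 * ν))) volume
    simp_rw [(Nat.not_even_iff_odd.mp hq).neg_pow, (even_two_mul ν).neg_pow, neg_mul,
      integral_neg] at h
    simp_rw [neg_mul]
    linarith

/-- Scaling: the factor `n ^ k` of a term `(n x ^ (2ν)) ^ k x ^ q` compensates the growth of the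
power of `x`, so that the order in `n` depends only on `q`. -/
theorem pow_mul_moment {ν : ℕ} (hν : 1 ≤ ν) (k q : ℕ) {c n : ℝ} (hc : 0 < c) (hn : 0 < n) :
    n ^ k * moment ν (2 * ν * k + q) (c * n) =
      moment ν (2 * ν * k + q) c * n ^ (-(((q : ℝ) + 1) / (2 * ν))) := by
  have hν' : (0 : ℝ) < ν := by exact_mod_cast hν
  have h : ((((2 * ν * k + q : ℕ) : ℝ)) + 1) / (2 * ν) = k + ((q : ℝ) + 1) / (2 * ν) := by
    push_cast; field_simp; ring
  rw [moment, moment, h, Real.mul_rpow hc.le hn.le, neg_add, Real.rpow_add hn,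
    Real.rpow_neg hn.le k, Real.rpow_natCast]
  field_simp

/-- Local form of the expansion: `exp (s u)` is expanded in powers of `u`, and these in powers of
`x`. The large parameter `s ≥ 0` is kept free, and half of the decay `exp (-c s)` pays for
`exp (s |u|)`. -/
theorem exp_expansion_local {c : ℝ} (hc : 0 < c) {u : ℝ → ℝ} {b : ℕ → ℝ} {K : ℕ}
    (hu : (fun x => u x - ∑ m ∈ Finset.range (K + 1), (if m = 0 then 0 else b m) * x ^ m)
      =O[𝓝 0] fun x : ℝ => x ^ (K + 1)) :
    ∃ D, 0 ≤ D ∧ ∀ᶠ x in 𝓝 (0 : ℝ), ∀ s, 0 ≤ s →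
      |Real.exp (s * (-c + u x)) - Real.exp (-c * s) * ∑ k ∈ Finset.range (K + 1),
          ∑ N ∈ Finset.range (K + 1), compSum b k N / k ! * (s ^ k * x ^ N)| ≤
        D * (|x| ^ (K + 1) * (∑ k ∈ Finset.range (K + 2), s ^ k * Real.exp (-(c / 2) * s))) := by
  have h1 : ∀ k, ∃ C, 0 < C ∧ ∀ᶠ x in 𝓝 (0 : ℝ),
      |u x ^ k - ∑ N ∈ Finset.range (K + 1), compSum b k N * x ^ N| ≤ C * |x| ^ (K + 1) := by
    intro k
    obtain ⟨C, hC, h⟩ := (pow_sub_sum_isBigO hu k).exists_pos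
    refine ⟨C, hC, h.bound.mono fun x hx => ?_⟩
    simpa [norm_pow] using hx
  choose C hC hCb using h1
  have hDk : ∀ k ∈ Finset.range (K + 2), C k ≤ ∑ k ∈ Finset.range (K + 2), C k := fun k hk =>
    Finset.single_le_sum (fun i _ => (hC i).le) hk
  refine ⟨∑ k ∈ Finset.range (K + 2), C k, Finset.sum_nonneg fun i _ => (hC i).le, ?_⟩
  set D := ∑ k ∈ Finset.range (K + 2), C k
  -- The coefficients of `u ^ (K + 1)` up to order `K` vanish.
  have htop : ∀ᶠ x in 𝓝 (0 : ℝ), |u x| ^ (K + 1) ≤ C (K + 1) * |x| ^ (K + 1) := by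
    refine (hCb (K + 1)).mono fun x hx => ?_
    rw [Finset.sum_eq_zero fun N hN => by
      rw [compSum_eq_zero_of_lt b (Finset.mem_range.mp hN), zero_mul], sub_zero, abs_pow] at hx
    exact hx
  have hsmall : ∀ᶠ x in 𝓝 (0 : ℝ), |u x| ≤ c / 2 := by
    have ht : Tendsto (fun x : ℝ => C (K + 1) * |x| ^ (K + 1)) (𝓝 0) (𝓝 0) := by
      have : Continuous fun x : ℝ => C (K + 1) * |x| ^ (K + 1) := by fun_prop
      simpa using this.tendsto 0
    filter_upwards [htop, ht.eventually_le_const (show (0 : ℝ) < (c / 2) ^ (K + 1) by positivity)]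
      with x h1 h2
    exact (pow_le_pow_iff_left₀ (abs_nonneg _) (by positivity) (by omega)).mp (h1.trans h2)
  have hall : ∀ᶠ x in 𝓝 (0 : ℝ), ∀ k ∈ Finset.range (K + 1),
      |u x ^ k - ∑ N ∈ Finset.range (K + 1), compSum b k N * x ^ N| ≤ C k * |x| ^ (K + 1) :=
    (eventually_all_finset _).mpr fun k _ => hCb k
  filter_upwards [htop, hsmall, hall] with x htop hsmall hall s hs
  have hexp : |Real.exp (s * u x) - ∑ k ∈ Finset.range (K + 1), (s * u x) ^ k / k !| ≤
      |s * u x| ^ (K + 1) * Real.exp |s * u x| := by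
    have := Complex.norm_exp_sub_sum_le_norm_mul_exp ((s * u x : ℝ) : ℂ) (K + 1)
    rw [Complex.norm_real, Real.norm_eq_abs, ← Real.norm_eq_abs (_ - _), ← Complex.norm_real] at *
    push_cast at this ⊢
    exact this
  have hsu : |s * u x| ≤ c / 2 * s := by
    rw [abs_mul, abs_of_nonneg hs, mul_comm]; gcongr
  have hone : 1 ≤ Real.exp (c / 2 * s) := Real.one_le_exp (by positivity)
  have hA : |Real.exp (s * u x) - ∑ k ∈ Finset.range (K + 1), (s * u x) ^ k / k !| ≤
      D * |x| ^ (K + 1) * s ^ (K + 1) * Real.exp (c / 2 * s) := by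
    refine hexp.trans ?_
    rw [abs_mul, mul_pow, abs_of_nonneg hs]
    have h1 : |u x| ^ (K + 1) ≤ D * |x| ^ (K + 1) :=
      htop.trans (by gcongr; exact hDk _ (by simp))
    have h0 : 0 ≤ D * |x| ^ (K + 1) := le_trans (by positivity) h1
    have h2 : s * |u x| ≤ c / 2 * s := by rwa [abs_mul, abs_of_nonneg hs] at hsu
    calc s ^ (K + 1) * |u x| ^ (K + 1) * Real.exp (s * |u x|)
        ≤ s ^ (K + 1) * (D * |x| ^ (K + 1)) * Real.exp (c / 2 * s) := by gcongr
      _ = _ := by ring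
  have hB : |∑ k ∈ Finset.range (K + 1), (s * u x) ^ k / (k !) - ∑ k ∈ Finset.range (K + 1),
          ∑ N ∈ Finset.range (K + 1), compSum b k N / k ! * (s ^ k * x ^ N)| ≤
      ∑ k ∈ Finset.range (K + 1), D * |x| ^ (K + 1) * s ^ k * Real.exp (c / 2 * s) := by
    rw [← Finset.sum_sub_distrib]
    refine (Finset.abs_sum_le_sum_abs _ _).trans (Finset.sum_le_sum fun k hk => ?_)
    have h1 : (s * u x) ^ k / (k !) -
        ∑ N ∈ Finset.range (K + 1), compSum b k N / k ! * (s ^ k * x ^ N) =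
        s ^ k / k ! * (u x ^ k - ∑ N ∈ Finset.range (K + 1), compSum b k N * x ^ N) := by
      rw [mul_sub, Finset.mul_sum]
      congr 1
      · ring
      · exact Finset.sum_congr rfl fun N _ => by ring
    have h2 : (1 : ℝ) ≤ k ! := by exact_mod_cast Nat.factorial_pos k
    have h3 : C k ≤ D := hDk k (by simp at hk ⊢; omega)
    rw [h1, abs_mul, abs_of_nonneg (by positivity)]
    calc s ^ k / k ! * |u x ^ k - ∑ N ∈ Finset.range (K + 1), compSum b k N * x ^ N|
        ≤ s ^ k * (D * |x| ^ (K + 1)) := by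
          gcongr
          · exact div_le_self (by positivity) h2
          · exact (hall k hk).trans (by gcongr)
      _ ≤ s ^ k * (D * |x| ^ (K + 1)) * Real.exp (c / 2 * s) := by
          have : 0 ≤ D := (hC k).le.trans h3
          exact le_mul_of_one_le_right (by positivity) hone
      _ = _ := by ring
  have hsplit : Real.exp (s * (-c + u x)) = Real.exp (-c * s) * Real.exp (s * u x) := by
    rw [← Real.exp_add]; ring_nf
  rw [hsplit, ← mul_sub, abs_mul, Real.abs_exp]
  calc Real.exp (-c * s) * |Real.exp (s * u x) - ∑ k ∈ Finset.range (K + 1),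
          ∑ N ∈ Finset.range (K + 1), compSum b k N / k ! * (s ^ k * x ^ N)|
      ≤ Real.exp (-c * s) * ∑ k ∈ Finset.range (K + 2),
          D * |x| ^ (K + 1) * s ^ k * Real.exp (c / 2 * s) := by
        refine mul_le_mul_of_nonneg_left ?_ (Real.exp_pos _).le
        rw [Finset.sum_range_succ _ (K + 1)]
        exact (abs_sub_le _ _ _).trans ((add_le_add hA hB).trans_eq (add_comm _ _))
    _ = _ := by
        rw [Finset.mul_sum, Finset.mul_sum, Finset.mul_sum]
        refine Finset.sum_congr rfl fun k _ => ?_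
        have : Real.exp (-(c / 2) * s) = Real.exp (-c * s) * Real.exp (c / 2 * s) := by
          rw [← Real.exp_add]; ring_nf
        rw [this]; ring

/-- The coefficients of the Laplace expansion of `∫ exp (n x ^ (2ν) (-c + b₁ x + b₂ x² + ⋯))` in
powers of `n ^ (-1 / (2ν))`; the odd ones vanish by symmetry. -/
noncomputable def laplaceCoeff (ν : ℕ) (c : ℝ) (b : ℕ → ℝ) (N : ℕ) : ℝ :=
  if Even N then
    ∑ k ∈ Finset.range (N + 1), compSum b k N / k ! * moment ν (2 * ν * k + N) c
  else 0

theorem laplaceCoeff_eq {ν : ℕ} {c : ℝ} {b : ℕ → ℝ} {N K : ℕ} (h : N ≤ K) :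
    laplaceCoeff ν c b N = ∑ k ∈ Finset.range (K + 1),
      compSum b k N / k ! * if Even N then moment ν (2 * ν * k + N) c else 0 := by
  unfold laplaceCoeff
  split_ifs with hN
  · refine Finset.sum_subset (Finset.range_mono (by omega)) fun k _ hk => ?_
    rw [compSum_eq_zero_of_lt b (by simpa using hk)]; simp
  · simp

/-- Laplace's method around a maximum at `0` at which the exponent vanishes to order `2ν`. The exact
form of the integrand is only required near `0`; elsewhere a Gaussian bound suffices, which allows
both for exponents that are merely quadratic at infinity when `ν > 1` and for integrands cut off
away from `0`. -/
theorem laplace_expansion {ν : ℕ} (hν : 1 ≤ ν) {c : ℝ} (hc : 0 < c) {u : ℝ → ℝ} {b : ℕ → ℝ}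
    {K : ℕ}
    (hu : (fun x => u x - ∑ m ∈ Finset.range (K + 1), (if m = 0 then 0 else b m) * x ^ m)
      =O[𝓝 0] fun x : ℝ => x ^ (K + 1))
    {F : ℕ → ℝ → ℝ} (hFm : ∀ n, Measurable (F n))
    (hF0 : ∀ᶠ x in 𝓝 (0 : ℝ), ∀ n : ℕ, F n x = Real.exp (n * x ^ (2 * ν) * (-c + u x)))
    (hF1 : ∀ δ > 0, ∃ L > 0, ∀ (n : ℕ) (x : ℝ), δ ≤ |x| → |F n x| ≤ Real.exp (-(L * n) * x ^ 2)) :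
    ∃ C, ∀ n : ℕ, 1 ≤ n →
      |(∫ x, F n x) - ∑ N ∈ Finset.range (K + 1), laplaceCoeff ν c b N *
        (n : ℝ) ^ (-(((N : ℝ) + 1) / (2 * ν)))| ≤ C * (n : ℝ) ^ (-(((K : ℝ) + 2) / (2 * ν))) := by
  obtain ⟨D, hD0, hD⟩ := exp_expansion_local hc hu
  obtain ⟨δ, hδ, hball⟩ := Metric.eventually_nhds_iff_ball.mp (hD.and hF0)
  obtain ⟨L, hL, hF1⟩ := hF1 δ hδ
  set P : ℕ → ℝ → ℝ := fun n x => Real.exp (-c * (n * x ^ (2 * ν))) * ∑ k ∈ Finset.range (K + 1),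
    ∑ N ∈ Finset.range (K + 1), compSum b k N / k ! * ((n * x ^ (2 * ν)) ^ k * x ^ N) with hP
  set W : ℕ → ℝ := fun k => ∑ N ∈ Finset.range (K + 1), |compSum b k N| * (1 / δ) ^ (K + 1 - N)
  have hW : ∀ k, 0 ≤ W k := fun k => Finset.sum_nonneg fun N _ => by positivity
  set E : ℝ := D + (∑ k ∈ Finset.range (K + 1), W k) + (1 / δ) ^ (K + 1) with hE
  have hE1 : D ≤ E := by
    have := Finset.sum_nonneg fun k (_ : k ∈ Finset.range (K + 1)) => hW k
    have : 0 < (1 / δ) ^ (K + 1) := by positivity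
    linarith
  have hE0 : 0 ≤ E := hD0.trans hE1
  set G : ℕ → ℝ → ℝ := fun n x => E * (∑ k ∈ Finset.range (K + 2),
    (n : ℝ) ^ k * (|x| ^ (2 * ν * k + (K + 1)) * Real.exp (-(c / 2 * n) * x ^ (2 * ν))) +
      |x| ^ (K + 1) * Real.exp (-(L * n) * x ^ (2 * 1))) with hG
  -- Beyond the radius `δ` the integrand `F` and its approximation `P` are bounded separately: the
  -- factor `|x| ^ (K + 1)` is gained from `1 ≤ |x| / δ`.
  have hFP : ∀ n x, |F n x - P n x| ≤ G n x := by
    intro n x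
    have hs : (0 : ℝ) ≤ n * x ^ (2 * ν) := by rw [pow_mul]; positivity
    have hGs : G n x = E * (|x| ^ (K + 1) * (∑ k ∈ Finset.range (K + 2),
        (n * x ^ (2 * ν)) ^ k * Real.exp (-(c / 2) * (n * x ^ (2 * ν)))) +
        |x| ^ (K + 1) * Real.exp (-(L * n) * x ^ 2)) := by
      simp only [hG, Finset.mul_sum]
      congr 2
      refine Finset.sum_congr rfl fun k _ => ?_
      rw [mul_pow, ← pow_mul x, ← (even_two_mul ν).mul_right k |>.pow_abs, pow_add]
      ring_nf
    rw [hGs]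
    set s := (n : ℝ) * x ^ (2 * ν) with hsd
    have hS0 : 0 ≤ ∑ k ∈ Finset.range (K + 2), s ^ k * Real.exp (-(c / 2) * s) :=
      Finset.sum_nonneg fun k _ => by positivity
    rcases lt_or_ge |x| δ with hx | hx
    · obtain ⟨h1, h2⟩ := hball x (by simpa using hx)
      rw [h2 n]
      refine (h1 s hs).trans ?_
      rw [mul_add]
      refine le_trans ?_ (le_add_of_nonneg_right (by positivity))
      gcongr
    · have hx1 : 1 ≤ |x| * (1 / δ) := by rwa [mul_one_div, one_le_div hδ]
      have hF : |F n x| ≤ (1 / δ) ^ (K + 1) * (|x| ^ (K + 1) * Real.exp (-(L * n) * x ^ 2)) := by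
        refine (hF1 n x hx).trans ?_
        rw [← mul_assoc, ← mul_pow, mul_comm (1 / δ)]
        exact le_mul_of_one_le_left (Real.exp_pos _).le (one_le_pow₀ hx1)
      have hPb : |P n x| ≤ (∑ k ∈ Finset.range (K + 1), W k) *
          (|x| ^ (K + 1) * ∑ k ∈ Finset.range (K + 2), s ^ k * Real.exp (-(c / 2) * s)) := by
        simp only [hP]
        rw [Finset.mul_sum, Finset.sum_mul]
        refine (Finset.abs_sum_le_sum_abs _ _).trans (Finset.sum_le_sum fun k hk => ?_)
        rw [Finset.mul_sum, Finset.sum_mul]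
        refine (Finset.abs_sum_le_sum_abs _ _).trans (Finset.sum_le_sum fun N hN => ?_)
        have hx2 : |x| ^ N ≤ (1 / δ) ^ (K + 1 - N) * |x| ^ (K + 1) := by
          have hNK : N + (K + 1 - N) = K + 1 := by
            have := Finset.mem_range.mp hN
            omega
          calc |x| ^ N ≤ |x| ^ N * (|x| * (1 / δ)) ^ (K + 1 - N) :=
                le_mul_of_one_le_right (by positivity) (one_le_pow₀ hx1)
            _ = (1 / δ) ^ (K + 1 - N) * |x| ^ (N + (K + 1 - N)) := by ring
            _ = _ := by rw [hNK]
        have hT : s ^ k * Real.exp (-(c / 2) * s) ≤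
            ∑ k ∈ Finset.range (K + 2), s ^ k * Real.exp (-(c / 2) * s) :=
          Finset.single_le_sum (f := fun k => s ^ k * Real.exp (-(c / 2) * s))
            (fun i _ => by positivity) (by simp at hk ⊢; omega)
        have he : Real.exp (-c * s) ≤ Real.exp (-(c / 2) * s) :=
          Real.exp_le_exp.mpr (by nlinarith)
        have hf : |compSum b k N| / k ! ≤ |compSum b k N| :=
          div_le_self (abs_nonneg _) (by exact_mod_cast Nat.factorial_pos k)
        rw [abs_mul, Real.abs_exp, abs_mul, abs_div, Nat.abs_cast, abs_mul, abs_pow, abs_pow,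
          abs_of_nonneg hs]
        calc Real.exp (-c * s) * (|compSum b k N| / k ! * (s ^ k * |x| ^ N))
            ≤ Real.exp (-(c / 2) * s) * (|compSum b k N| *
                (s ^ k * ((1 / δ) ^ (K + 1 - N) * |x| ^ (K + 1)))) := by gcongr
          _ = |compSum b k N| * (1 / δ) ^ (K + 1 - N) *
                (|x| ^ (K + 1) * (s ^ k * Real.exp (-(c / 2) * s))) := by ring
          _ ≤ _ := by gcongr
      calc |F n x - P n x| ≤ |F n x| + |P n x| := abs_sub _ _
        _ ≤ _ := add_le_add hF hPb
        _ ≤ E * (|x| ^ (K + 1) * Real.exp (-(L * n) * x ^ 2)) +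
            E * (|x| ^ (K + 1) * ∑ k ∈ Finset.range (K + 2), s ^ k * Real.exp (-(c / 2) * s)) := by
          have h1 := Finset.sum_nonneg fun k (_ : k ∈ Finset.range (K + 1)) => hW k
          have h2 : 0 < (1 / δ) ^ (K + 1) := by positivity
          gcongr <;> linarith
        _ = _ := by ring
  have hPi : ∀ n : ℕ, 1 ≤ n → Integrable (P n) ∧ ∫ x, P n x =
      ∑ N ∈ Finset.range (K + 1), laplaceCoeff ν c b N *
        (n : ℝ) ^ (-(((N : ℝ) + 1) / (2 * ν))) := by
    intro n hn
    have hn' : (0 : ℝ) < n := by exact_mod_cast hn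
    have hPe : P n = fun x => ∑ k ∈ Finset.range (K + 1), ∑ N ∈ Finset.range (K + 1),
        compSum b k N / k ! * (n : ℝ) ^ k *
          (x ^ (2 * ν * k + N) * Real.exp (-(c * n) * x ^ (2 * ν))) := by
      funext x
      simp only [hP, Finset.mul_sum]
      refine Finset.sum_congr rfl fun k _ => Finset.sum_congr rfl fun N _ => ?_
      rw [mul_pow, pow_add, pow_mul x (2 * ν) k]
      ring_nf
    have hi := fun q => integrable_pow_mul_exp hν q (mul_pos hc hn')
    rw [hPe]
    refine ⟨integrable_finsetSum _ fun k _ => integrable_finsetSum _ fun N _ =>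
      (hi _).const_mul _, ?_⟩
    rw [integral_finsetSum _ fun k _ => integrable_finsetSum _ fun N _ => (hi _).const_mul _,
      Finset.sum_congr rfl fun k _ => integral_finsetSum _ fun N _ => (hi _).const_mul _,
      Finset.sum_comm]
    refine Finset.sum_congr rfl fun N hN => ?_
    rw [laplaceCoeff_eq (K := K) (by simpa [Nat.lt_succ_iff] using hN), Finset.sum_mul]
    refine Finset.sum_congr rfl fun k _ => ?_
    rw [integral_const_mul, integral_pow_mul_exp hν _ (mul_pos hc hn')]
    have he : Even (2 * ν * k + N) ↔ Even N := by
      rw [Nat.even_add]; simp [mul_assoc]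
    simp only [he]
    split_ifs
    · rw [mul_assoc (compSum b k N / (k !)), mul_assoc (compSum b k N / (k !)),
        pow_mul_moment hν k N hc hn']
    · simp
  set C : ℝ := E * (∑ k ∈ Finset.range (K + 2), moment ν (2 * ν * k + (K + 1)) (c / 2) +
    moment 1 (K + 1) L)
  refine ⟨C, fun n hn => ?_⟩
  have hn' : (0 : ℝ) < n := by exact_mod_cast hn
  obtain ⟨hPint, hPval⟩ := hPi n hn
  have hi1 := fun q => integrable_abs_pow_mul_exp hν q (mul_pos (half_pos hc) hn')
  have hi2 := integrable_abs_pow_mul_exp le_rfl (K + 1) (mul_pos hL hn')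
  have hGi : Integrable (G n) :=
    ((integrable_finsetSum _ fun k _ => (hi1 _).const_mul _).add hi2).const_mul E
  have hFPm : AEStronglyMeasurable (fun x => F n x - P n x) volume :=
    (hFm n).aestronglyMeasurable.sub hPint.aestronglyMeasurable
  have hFPi : Integrable (fun x => F n x - P n x) :=
    hGi.mono' hFPm (ae_of_all _ fun x => hFP n x)
  have hFi : Integrable (F n) := by
    have := hFPi.add hPint
    simpa only [Pi.add_def, sub_add_cancel] using this
  rw [← hPval, ← integral_sub hFi hPint]
  calc |∫ x, (F n x - P n x)| ≤ ∫ x, G n x :=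
        norm_integral_le_of_norm_le (f := fun x => F n x - P n x) hGi
          (ae_of_all _ fun x => hFP n x)
    _ = E * (∑ k ∈ Finset.range (K + 2), (n : ℝ) ^ k * moment ν (2 * ν * k + (K + 1)) (c / 2 * n) +
          moment 1 (K + 1) (L * n)) := by
        simp only [hG]
        rw [integral_const_mul, integral_add (integrable_finsetSum _ fun k _ =>
          (hi1 _).const_mul _) hi2, integral_finsetSum _ fun k _ => (hi1 _).const_mul _,
          integral_abs_pow_mul_exp le_rfl _ (mul_pos hL hn')]
        simp only [integral_const_mul, integral_abs_pow_mul_exp hν _ (mul_pos (half_pos hc) hn')]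
    _ ≤ _ := by
        have h1 : moment 1 (K + 1) (L * n) ≤
            moment 1 (K + 1) L * (n : ℝ) ^ (-(((K : ℝ) + 2) / (2 * ν))) := by
          have h := pow_mul_moment le_rfl 0 (K + 1) hL hn'
          simp only [pow_zero, one_mul, mul_zero, zero_add] at h
          rw [h]
          refine mul_le_mul_of_nonneg_left ?_ (moment_pos le_rfl _ hL).le
          refine Real.rpow_le_rpow_of_exponent_le (by exact_mod_cast hn) (neg_le_neg ?_)
          have hν' : (1 : ℝ) ≤ ν := by exact_mod_cast hν
          push_cast
          rw [add_assoc, one_add_one_eq_two]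
          gcongr
        rw [mul_assoc]
        refine mul_le_mul_of_nonneg_left ?_ hE0
        rw [add_mul, Finset.sum_mul]
        refine add_le_add (Finset.sum_le_sum fun k _ => ?_) h1
        rw [pow_mul_moment hν k (K + 1) (half_pos hc) hn']
        push_cast
        rw [add_assoc (K : ℝ), one_add_one_eq_two]

/-! ### The Hubbard–Stratonovich transformation -/

theorem sum_exp_mul_sum (n : ℕ) (t : ℝ) :
    ∑ σ ∈ Fintype.piFinset (fun _ : Fin n => ({-1, 1} : Finset ℝ)), Real.exp (t * ∑ j, σ j) =
      (2 * Real.cosh t) ^ n := by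
  simp_rw [Finset.mul_sum, Real.exp_sum]
  rw [← Finset.prod_univ_sum (fun _ : Fin n => ({-1, 1} : Finset ℝ))
    (fun _ s => Real.exp (t * s))]
  have h : ∑ s ∈ ({-1, 1} : Finset ℝ), Real.exp (t * s) = 2 * Real.cosh t := by
    rw [Finset.sum_pair (by norm_num), Real.cosh_eq]
    ring_nf
  simp [h]

theorem Z_neg (d : ℕ) (β h : ℝ) (n : ℕ) : Z d β (-h) n = Z d β h n := by
  unfold Z
  refine Finset.sum_equiv (Equiv.neg _) (fun σ => ?_) (fun σ _ => ?_)
  · simp only [Fintype.mem_piFinset, Finset.mem_insert, Finset.mem_singleton, Equiv.neg_apply,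
      Pi.neg_apply]
    refine forall_congr' fun i => ?_
    rw [neg_inj, neg_eq_iff_eq_neg, or_comm]
  · simp

theorem Z_abs (d : ℕ) (β h : ℝ) (n : ℕ) : Z d β |h| n = Z d β h n := by
  rcases abs_choice h with h1 | h1 <;> rw [h1]
  exact Z_neg d β h n

theorem Z_beta_zero (d : ℕ) (h : ℝ) (n : ℕ) :
    Z d 0 h n = 2 ^ n * Real.exp (n * Real.log (Real.cosh |h|)) := by
  rw [← Z_abs, Real.exp_nat_mul, Real.exp_log (Real.cosh_pos _), ← mul_pow, ← sum_exp_mul_sum]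
  simp [Z]

/-- Completing the square in a Gaussian integral. -/
theorem exp_mul_gaussian_eq (S h t : ℝ) {b : ℝ} (hb : 0 < b) :
    Real.exp (t * S) * Real.exp (-b * (t - h) ^ 2) =
      Real.exp (S ^ 2 / (4 * b) + h * S) * Real.exp (-b * (t - (h + S / (2 * b))) ^ 2) := by
  rw [← Real.exp_add, ← Real.exp_add]
  congr 1
  field_simp
  ring

theorem integrable_exp_mul_gaussian (S h : ℝ) {b : ℝ} (hb : 0 < b) :
    Integrable fun t : ℝ => Real.exp (t * S) * Real.exp (-b * (t - h) ^ 2) := by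
  simp_rw [exp_mul_gaussian_eq S h _ hb]
  exact ((integrable_exp_neg_mul_sq hb).comp_sub_right _).const_mul _

theorem integral_exp_mul_gaussian (S h : ℝ) {b : ℝ} (hb : 0 < b) :
    ∫ t : ℝ, Real.exp (t * S) * Real.exp (-b * (t - h) ^ 2) =
      Real.exp (S ^ 2 / (4 * b) + h * S) * √(Real.pi / b) := by
  simp_rw [exp_mul_gaussian_eq S h _ hb]
  rw [integral_const_mul, integral_sub_right_eq_self (fun t => Real.exp (-b * t ^ 2)),
    integral_gaussian]

/-- The Hubbard–Stratonovich transformation: a Gaussian integral linearizes the square of the total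
spin, after which the sum over the spins factorizes. -/
theorem Z_eq_integral {d : ℕ} (hd : 1 ≤ d) {β : ℝ} (hβ : 0 < β) (h : ℝ) {n : ℕ} (hn : 1 ≤ n) :
    Z d β h n = 2 ^ n * (√(n / (4 * Real.pi * d * β)) * ∫ t, Real.exp (n * phi d β h t)) := by
  have hn' : (0 : ℝ) < n := by exact_mod_cast hn
  have hd' : (0 : ℝ) < d := by exact_mod_cast hd
  have hb : (0 : ℝ) < n / (4 * d * β) := by positivity
  have h1 : ∀ t, 2 ^ n * Real.exp (n * phi d β h t) =
      ∑ σ ∈ Fintype.piFinset (fun _ : Fin n => ({-1, 1} : Finset ℝ)),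
        Real.exp (t * ∑ j, σ j) * Real.exp (-(n / (4 * d * β)) * (t - |h|) ^ 2) := by
    intro t
    rw [← Finset.sum_mul, sum_exp_mul_sum, phi, mul_sub, Real.exp_sub, Real.exp_nat_mul,
      Real.exp_log (Real.cosh_pos _), mul_pow, neg_mul, Real.exp_neg]
    ring_nf
  have hpi := Real.pi_pos
  have h2 : √(n / (4 * Real.pi * d * β)) * √(Real.pi / (n / (4 * d * β))) = 1 := by
    rw [← Real.sqrt_mul (by positivity), Real.sqrt_eq_one]
    field_simp
  rw [mul_left_comm, ← integral_const_mul]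
  simp_rw [h1]
  rw [integral_finsetSum _ fun σ _ => integrable_exp_mul_gaussian _ _ hb, ← Z_abs, Z,
    Finset.mul_sum]
  refine Finset.sum_congr rfl fun σ _ => ?_
  rw [integral_exp_mul_gaussian _ _ hb, mul_left_comm, h2, mul_one]
  congr 2
  field_simp

/-! ### The function `φ`: Taylor coefficients, decay and maximum points -/

theorem hasDerivAt_tanh (t : ℝ) : HasDerivAt Real.tanh (1 - Real.tanh t ^ 2) t := by
  have hc := (Real.cosh_pos t).ne'
  have h := (Real.hasDerivAt_sinh t).div (Real.hasDerivAt_cosh t) hc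
  have h1 : Real.tanh = Real.sinh / Real.cosh := by
    funext x; exact Real.tanh_eq_sinh_div_cosh x
  rw [h1]
  refine h.congr_deriv ?_
  rw [Pi.div_apply]
  field_simp

theorem one_sub_tanh_sq (t : ℝ) : 1 - Real.tanh t ^ 2 = 1 / Real.cosh t ^ 2 := by
  have hc := (Real.cosh_pos t).ne'
  rw [Real.tanh_eq_sinh_div_cosh]
  field_simp
  linarith [Real.cosh_sq_sub_sinh_sq t]

theorem hasDerivAt_phi (d : ℕ) (β h t : ℝ) :
    HasDerivAt (phi d β h) (Real.tanh t - (t - |h|) / (2 * d * β)) t := by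
  have h1 : HasDerivAt (fun t => Real.log (Real.cosh t)) (Real.tanh t) t := by
    rw [Real.tanh_eq_sinh_div_cosh]
    exact (Real.hasDerivAt_cosh t).log (Real.cosh_pos t).ne'
  have h2 : HasDerivAt (fun t : ℝ => (t - |h|) ^ 2 / (4 * d * β))
      ((2 : ℕ) * (t - |h|) ^ (2 - 1) * 1 / (4 * d * β)) t :=
    (((hasDerivAt_id t).sub_const |h|).pow 2).div_const _
  have h3 : (t - |h|) / (2 * d * β) = (2 : ℕ) * (t - |h|) ^ (2 - 1) * 1 / (4 * d * β) := by
    rw [show (4 * d * β : ℝ) = 2 * (2 * d * β) by ring, ← mul_div_mul_left _ _ two_ne_zero]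
    norm_num
  rw [h3]
  exact h1.sub h2

theorem continuous_phi (d : ℕ) (β h : ℝ) : Continuous (phi d β h) :=
  continuous_iff_continuousAt.mpr fun t => (hasDerivAt_phi d β h t).continuousAt

theorem analyticAt_phi (d : ℕ) (β h t : ℝ) : AnalyticAt ℝ (phi d β h) t := by
  have h1 : AnalyticAt ℝ (fun t => Real.log (Real.cosh t)) t :=
    Real.analyticAt_cosh.log (Real.cosh_pos t)
  have h2 : AnalyticAt ℝ (fun t : ℝ => (t - |h|) ^ 2 / (4 * d * β)) t := by fun_prop
  exact h1.sub h2

theorem phi_taylor (d : ℕ) (β h t : ℝ) (Q : ℕ) :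
    (fun x => phi d β h (t + x) - ∑ q ∈ Finset.range Q, a d β h t q * x ^ q)
      =O[𝓝 0] fun x : ℝ => x ^ Q := by
  have h1 := (analyticAt_phi d β h t).hasFPowerSeriesAt.isBigO_sub_partialSum_pow Q
  refine (h1.congr_left fun x => ?_).trans (isBigO_of_le _ fun x => by simp)
  simp only [FormalMultilinearSeries.partialSum, FormalMultilinearSeries.ofScalars_apply_eq,
    smul_eq_mul, a]

theorem deriv_phi (d : ℕ) (β h : ℝ) :
    deriv (phi d β h) = fun t => Real.tanh t - (t - |h|) / (2 * d * β) :=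
  funext fun t => (hasDerivAt_phi d β h t).deriv

theorem hasDerivAt_deriv_phi (d : ℕ) (β h t : ℝ) :
    HasDerivAt (fun t => Real.tanh t - (t - |h|) / (2 * d * β))
      (1 - Real.tanh t ^ 2 - 1 / (2 * d * β)) t :=
  (hasDerivAt_tanh t).sub (((hasDerivAt_id t).sub_const |h|).div_const _)

theorem a_zero (d : ℕ) (β h t : ℝ) : a d β h t 0 = phi d β h t := by simp [a]

theorem a_one (d : ℕ) (β h t : ℝ) :
    a d β h t 1 = Real.tanh t - (t - |h|) / (2 * d * β) := by
  simp [a, deriv_phi]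

theorem a_two (d : ℕ) (β h t : ℝ) :
    a d β h t 2 = (1 - Real.tanh t ^ 2 - 1 / (2 * d * β)) / 2 := by
  rw [a, iteratedDeriv_succ', iteratedDeriv_one, deriv_phi, (hasDerivAt_deriv_phi d β h t).deriv]
  norm_num [Nat.factorial]

theorem a_four_zero (d : ℕ) (β : ℝ) : a d β 0 0 4 = -(1 / 12) := by
  have h2 : deriv (fun t => Real.tanh t - (t - |(0 : ℝ)|) / (2 * d * β)) =
      fun t => 1 - Real.tanh t ^ 2 - 1 / (2 * d * β) :=
    funext fun t => (hasDerivAt_deriv_phi d β 0 t).deriv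
  have h3 : deriv (fun t => 1 - Real.tanh t ^ 2 - 1 / (2 * d * β)) =
      fun t => -2 * Real.tanh t + 2 * Real.tanh t ^ 3 := by
    funext t
    have := (((hasDerivAt_tanh t).pow 2).const_sub 1).sub_const (1 / (2 * d * β))
    refine this.deriv.trans ?_
    norm_num
    ring
  have h4 : HasDerivAt (fun t => -2 * Real.tanh t + 2 * Real.tanh t ^ 3) (-2) 0 := by
    have := ((hasDerivAt_tanh 0).const_mul (-2)).add (((hasDerivAt_tanh 0).pow 3).const_mul 2)
    exact this.congr_deriv (by simp)
  rw [a, iteratedDeriv_succ', iteratedDeriv_succ', iteratedDeriv_succ', iteratedDeriv_one,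
    deriv_phi, h2, h3, h4.deriv]
  norm_num [Nat.factorial]

theorem phi_zero_field_neg (d : ℕ) (β t : ℝ) : phi d β 0 (-t) = phi d β 0 t := by
  simp [phi]

theorem a_odd (d : ℕ) (β : ℝ) {q : ℕ} (hq : Odd q) : a d β 0 0 q = 0 := by
  have h := iteratedDeriv_comp_neg q (phi d β 0) 0
  simp only [phi_zero_field_neg, hq.neg_one_pow, neg_zero, smul_eq_mul, neg_one_mul] at h
  rw [a, show iteratedDeriv q (phi d β 0) 0 = 0 by linarith, zero_div]

theorem log_cosh_le_abs (t : ℝ) : Real.log (Real.cosh t) ≤ |t| := by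
  rw [Real.log_le_iff_le_exp (Real.cosh_pos t), ← Real.cosh_abs, Real.cosh_eq]
  have : Real.exp (-|t|) ≤ Real.exp |t| :=
    Real.exp_le_exp.mpr (by linarith [abs_nonneg t])
  linarith

theorem cosh_lt_exp_half_sq {t : ℝ} (ht : t ≠ 0) : Real.cosh t < Real.exp (t ^ 2 / 2) := by
  -- Apply the weak inequality at `t / 2` and the duplication formula.
  have h1 := Real.cosh_le_exp_half_sq (t / 2)
  have h2 : Real.cosh t = 2 * Real.cosh (t / 2) ^ 2 - 1 := by
    have := Real.cosh_two_mul (t / 2)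
    rw [show 2 * (t / 2) = t by ring] at this
    linarith [Real.cosh_sq_sub_sinh_sq (t / 2)]
  have h3 : Real.exp (t ^ 2 / 2) = (Real.exp ((t / 2) ^ 2 / 2) ^ 2) ^ 2 := by
    rw [← pow_mul, ← Real.exp_nat_mul]
    congr 1
    push_cast
    ring
  have h4 : 1 < Real.exp ((t / 2) ^ 2 / 2) ^ 2 :=
    one_lt_pow₀ (Real.one_lt_exp_iff.mpr (by positivity)) two_ne_zero
  have h5 : Real.cosh (t / 2) ^ 2 ≤ Real.exp ((t / 2) ^ 2 / 2) ^ 2 :=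
    pow_le_pow_left₀ (Real.cosh_pos _).le h1 2
  rw [h2, h3]
  nlinarith [sq_nonneg (Real.exp ((t / 2) ^ 2 / 2) ^ 2 - 1)]

theorem phi_lt_phi_zero {d : ℕ} (hd : 1 ≤ d) {β : ℝ} (hβ : 0 < β) (hβc : 2 * d * β ≤ 1) {t : ℝ}
    (ht : t ≠ 0) : phi d β 0 t < phi d β 0 0 := by
  have hd' : (0 : ℝ) < d := by exact_mod_cast hd
  have h1 : Real.log (Real.cosh t) < t ^ 2 / 2 := by
    rw [Real.log_lt_iff_lt_exp (Real.cosh_pos t)]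
    exact cosh_lt_exp_half_sq ht
  have h2 : t ^ 2 / 2 ≤ t ^ 2 / (4 * d * β) :=
    div_le_div_of_nonneg_left (by positivity) (by positivity) (by linarith)
  simp only [phi, abs_zero, sub_zero, Real.cosh_zero, Real.log_one]
  norm_num
  linarith

/-- A strict maximum of `φ` over a closed set is quantitatively strict away from the maximum
point: by compactness at bounded distance, and by the quadratic decay of `φ` at infinity. -/
theorem exists_phi_sub_le {d : ℕ} (hd : 1 ≤ d) {β : ℝ} (hβ : 0 < β) {h t : ℝ} {S : Set ℝ}
    (hS : IsClosed S) (hmax : ∀ s ∈ S, s ≠ t → phi d β h s < phi d β h t) {δ : ℝ} (hδ : 0 < δ) :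
    ∃ L > 0, ∀ x, t + x ∈ S → δ ≤ |x| → phi d β h (t + x) - phi d β h t ≤ -L * x ^ 2 := by
  have hd' : (0 : ℝ) < d := by exact_mod_cast hd
  set κ : ℝ := 1 / (4 * d * β) with hκd
  have hκ : 0 < κ := by positivity
  set A : ℝ := |t| + |phi d β h t|
  set B : ℝ := 1 + 2 * κ * |(t - |h|)|
  have hA : 0 ≤ A := by positivity
  have hB : 0 ≤ B := by positivity
  set R : ℝ := max 1 ((A + B) * 2 / κ)
  have hfar : ∀ x, R ≤ |x| → phi d β h (t + x) - phi d β h t ≤ -(κ / 2) * x ^ 2 := by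
    intro x hx
    have hx1 : 1 ≤ |x| := (le_max_left _ _).trans hx
    have hx2 : (A + B) * 2 ≤ |x| * κ := by
      rw [← div_le_iff₀ hκ]
      exact (le_max_right _ _).trans hx
    have h1 : phi d β h (t + x) ≤ |t| + |x| - κ * (t + x - |h|) ^ 2 := by
      have := (log_cosh_le_abs (t + x)).trans (abs_add_le t x)
      rw [phi, hκd, one_div_mul_eq_div]
      linarith
    have h2 : -(x * (t - |h|)) ≤ |x| * |(t - |h|)| := by
      rw [← abs_mul]
      exact neg_le_abs _
    have h3 := neg_abs_le (phi d β h t)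
    have h4 : |x| ^ 2 = x ^ 2 := sq_abs x
    have h5 : 0 ≤ κ * (t - |h|) ^ 2 := by positivity
    have h6 := mul_le_mul_of_nonneg_left h2 hκ.le
    have h7 : A ≤ A * |x| := le_mul_of_one_le_right hA hx1
    have h8 := mul_le_mul_of_nonneg_right hx2 (abs_nonneg x)
    have h9 : A + B * |x| ≤ κ / 2 * x ^ 2 := by nlinarith
    have h10 : B * |x| = |x| + 2 * (κ * (|x| * |(t - |h|)|)) := by ring
    have h11 : A = |t| + |phi d β h t| := rfl
    nlinarith
  set T : Set ℝ := {x | t + x ∈ S ∧ δ ≤ |x| ∧ |x| ≤ R}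
  have hT : IsCompact T := by
    refine (isCompact_Icc (a := -R) (b := R)).of_isClosed_subset ?_ fun x hx => abs_le.mp hx.2.2
    exact (hS.preimage (by fun_prop : Continuous fun x => t + x)).inter
      ((isClosed_le continuous_const continuous_abs).inter
        (isClosed_le continuous_abs continuous_const))
  have hT0 : ∀ x ∈ T, x ≠ 0 := fun x hx h0 => by
    have := hx.2.1
    rw [h0, abs_zero] at this
    linarith
  rcases T.eq_empty_or_nonempty with hTe | hTne
  · refine ⟨κ / 2, by positivity, fun x hxS hx => hfar x ?_⟩
    by_contra hR
    exact Set.eq_empty_iff_forall_notMem.mp hTe x ⟨hxS, hx, (not_le.mp hR).le⟩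
  · have hcont : ContinuousOn (fun x => (phi d β h (t + x) - phi d β h t) / x ^ 2) T := by
      have := continuous_phi d β h
      refine ContinuousOn.div (by fun_prop) (by fun_prop) fun x hx => pow_ne_zero 2 (hT0 x hx)
    obtain ⟨y, hy, hymax⟩ := hT.exists_isMaxOn hTne hcont
    have hy0 := hT0 y hy
    have hneg : (phi d β h (t + y) - phi d β h t) / y ^ 2 < 0 :=
      div_neg_of_neg_of_pos (sub_neg.mpr (hmax _ hy.1 (by simpa using hy0))) (by positivity)
    refine ⟨min (κ / 2) (-((phi d β h (t + y) - phi d β h t) / y ^ 2)),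
      lt_min (by positivity) (by linarith), fun x hxS hx => ?_⟩
    rcases le_or_gt R |x| with hR | hR
    · refine (hfar x hR).trans ?_
      have := min_le_left (κ / 2) (-((phi d β h (t + y) - phi d β h t) / y ^ 2))
      nlinarith [sq_nonneg x]
    · have hxT : x ∈ T := ⟨hxS, hx, hR.le⟩
      have hx0 := hT0 x hxT
      have h1 := hymax hxT
      simp only [Set.mem_ofPred_eq] at h1
      have h2 := min_le_right (κ / 2) (-((phi d β h (t + y) - phi d β h t) / y ^ 2))
      have hx2 : 0 < x ^ 2 := by positivity
      rw [div_le_iff₀ hx2] at h1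
      nlinarith

/-- Existence of the positive maximum point of `φ`: the derivative is strictly concave on
`[0, ∞)`, takes a positive value and is nonnegative at `0`, and is eventually negative. -/
theorem exists_maximum_point {d : ℕ} (hd : 1 ≤ d) {β h : ℝ} (hβ : 0 < β)
    (hh : h ≠ 0 ∨ 1 < 2 * d * β) :
    ∃ t, 0 < t ∧ Real.tanh t - (t - |h|) / (2 * d * β) = 0 ∧
      (∀ s, t < s → Real.tanh s - (s - |h|) / (2 * d * β) < 0) ∧
      (∀ s, 0 < s → s < t → 0 < Real.tanh s - (s - |h|) / (2 * d * β)) ∧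
      1 - Real.tanh t ^ 2 - 1 / (2 * d * β) < 0 := by
  have hd' : (0 : ℝ) < d := by exact_mod_cast hd
  have hB : 0 < 2 * d * β := by positivity
  set g : ℝ → ℝ := fun t => Real.tanh t - (t - |h|) / (2 * d * β) with hg
  have hgd : ∀ t, HasDerivAt g (1 - Real.tanh t ^ 2 - 1 / (2 * d * β)) t :=
    hasDerivAt_deriv_phi d β h
  have hgc : Continuous g := continuous_iff_continuousAt.mpr fun t => (hgd t).continuousAt
  have hanti : StrictAntiOn (fun t => 1 - Real.tanh t ^ 2 - 1 / (2 * d * β)) (Set.Ici 0) := by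
    intro x hx y hy hxy
    simp only [one_sub_tanh_sq]
    have h1 : Real.cosh x < Real.cosh y := Real.cosh_strictMonoOn hx hy hxy
    have := Real.cosh_pos x
    gcongr
  have hconc : StrictConcaveOn ℝ (Set.Ici 0) g := by
    refine StrictAntiOn.strictConcaveOn_of_deriv (convex_Ici 0) hgc.continuousOn ?_
    rw [interior_Ici, funext fun t => (hgd t).deriv]
    exact hanti.mono Set.Ioi_subset_Ici_self
  have hg0 : g 0 = |h| / (2 * d * β) := by simp [hg, neg_div]
  have hg0' : 0 ≤ g 0 := by rw [hg0]; positivity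
  obtain ⟨ε, hε, hgε⟩ : ∃ ε > 0, 0 < g ε := by
    rcases hh with hh | hh
    · have : 0 < g 0 := by
        have := abs_pos.mpr hh
        rw [hg0]; positivity
      have h1 : ∀ᶠ x in 𝓝[>] (0 : ℝ), 0 < g x :=
        (hgc.tendsto 0).eventually_const_lt this |>.filter_mono nhdsWithin_le_nhds
      obtain ⟨x, hx1, hx2⟩ := (h1.and self_mem_nhdsWithin).exists
      exact ⟨x, hx2, hx1⟩
    · have h1 : ∀ᶠ x in 𝓝[>] (0 : ℝ), 0 < slope g 0 x := by
        have := (hasDerivAt_iff_tendsto_slope.mp (hgd 0)).mono_left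
          (nhdsWithin_mono 0 (fun x (hx : x ∈ Set.Ioi (0 : ℝ)) => (ne_of_gt hx : x ≠ 0)))
        refine this.eventually_const_lt ?_
        have : 1 / (2 * d * β) < 1 := by rw [div_lt_one hB]; exact hh
        simp only [Real.tanh_zero]
        linarith
      obtain ⟨x, hx1, hx2⟩ := (h1.and self_mem_nhdsWithin).exists
      refine ⟨x, hx2, ?_⟩
      rw [slope_def_field, sub_zero] at hx1
      have := (div_pos_iff_of_pos_right (hx2 : 0 < x)).mp hx1
      linarith
  set T : ℝ := |h| + 2 * d * β + ε
  have hgT : g T < 0 := by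
    have h1 := Real.tanh_lt_one T
    have h2 : 1 ≤ (T - |h|) / (2 * d * β) := by
      rw [one_le_div hB]
      simp only [T]; linarith
    simp only [hg]; linarith
  have hεT : ε ≤ T := by
    have := abs_nonneg h
    simp only [T]; linarith
  obtain ⟨t, ht, hgt⟩ := intermediate_value_Icc' hεT hgc.continuousOn
    (Set.mem_Icc.mpr ⟨hgT.le, hgε.le⟩)
  have ht0 : 0 < t := hε.trans_le ht.1
  refine ⟨t, ht0, hgt, fun s hs => ?_, fun s hs0 hst => ?_, ?_⟩
  · by_contra hc
    have := hconc.lt_on_openSegment (Set.mem_Ici.mpr le_rfl)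
      (Set.mem_Ici.mpr (ht0.trans hs).le) (ht0.trans hs).ne
      (by rw [openSegment_eq_Ioo (ht0.trans hs)]; exact ⟨ht0, hs⟩ : t ∈ openSegment ℝ 0 s)
    rw [hgt] at this
    exact absurd this (not_lt.mpr (le_min hg0' (not_lt.mp hc)))
  · have := hconc.lt_on_openSegment (Set.mem_Ici.mpr le_rfl) (Set.mem_Ici.mpr ht0.le) ht0.ne
      (by rw [openSegment_eq_Ioo ht0]; exact ⟨hs0, hst⟩ : s ∈ openSegment ℝ 0 t)
    rw [hgt, min_eq_right hg0'] at this
    exact this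
  · by_contra hc
    have hmono : StrictMonoOn g (Set.Icc 0 t) := by
      refine strictMonoOn_of_deriv_pos (convex_Icc 0 t) hgc.continuousOn fun x hx => ?_
      rw [interior_Icc] at hx
      rw [(hgd x).deriv]
      exact (not_lt.mp hc).trans_lt
        (hanti (Set.mem_Ici.mpr hx.1.le) (Set.mem_Ici.mpr ht0.le) hx.2)
    have := hmono ⟨le_rfl, ht0.le⟩ ⟨ht0.le, le_rfl⟩ ht0
    rw [hgt] at this
    linarith

theorem phi_lt_of_nonneg {d : ℕ} {β h t : ℝ} (ht : 0 < t)
    (hneg : ∀ s, t < s → Real.tanh s - (s - |h|) / (2 * d * β) < 0)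
    (hpos : ∀ s, 0 < s → s < t → 0 < Real.tanh s - (s - |h|) / (2 * d * β))
    {s : ℝ} (hs : 0 ≤ s) (hst : s ≠ t) : phi d β h s < phi d β h t := by
  rcases lt_or_gt_of_ne hst with hlt | hgt
  · refine strictMonoOn_of_deriv_pos (convex_Icc 0 t) (continuous_phi d β h).continuousOn
      (fun x hx => ?_) ⟨hs, hlt.le⟩ ⟨ht.le, le_rfl⟩ hlt
    rw [interior_Icc] at hx
    rw [deriv_phi]
    exact hpos x hx.1 hx.2
  · refine strictAntiOn_of_deriv_neg (convex_Ici t) (continuous_phi d β h).continuousOn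
      (fun x hx => ?_) (Set.mem_Ici.mpr le_rfl) (Set.mem_Ici.mpr hgt.le) hgt
    rw [interior_Ici] at hx
    rw [deriv_phi]
    exact hneg x hx

theorem phi_lt_phi_neg {d : ℕ} (hd : 1 ≤ d) {β h : ℝ} (hβ : 0 < β) (hh : h ≠ 0) {s : ℝ}
    (hs : s < 0) : phi d β h s < phi d β h (-s) := by
  have hd' : (0 : ℝ) < d := by exact_mod_cast hd
  have := abs_pos.mpr hh
  simp only [phi, Real.cosh_neg]
  have h1 : (-s - |h|) ^ 2 < (s - |h|) ^ 2 := by nlinarith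
  have h2 := div_lt_div_of_pos_right h1 (show 0 < 4 * d * β by positivity)
  linarith

theorem isGreatest_tanh {B h t : ℝ} (hB : 0 < B) (ht0 : Real.tanh t - (t - h) / B = 0)
    (hneg : ∀ s, t < s → Real.tanh s - (s - h) / B < 0) :
    IsGreatest {y : ℝ | Real.tanh (B * y + h) = y} ((t - h) / B) := by
  refine ⟨?_, fun y hy => ?_⟩
  · have : B * ((t - h) / B) + h = t := by field_simp; ring
    rw [Set.mem_ofPred_eq, this]
    linarith
  · rw [Set.mem_ofPred_eq] at hy
    by_contra hc
    rw [not_le, div_lt_iff₀ hB] at hc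
    have := hneg (B * y + h) (by linarith)
    rw [hy, add_sub_cancel_right, mul_div_cancel_left₀ _ hB.ne'] at this
    linarith

/-! ### The expansions of the partition function -/

/-- The Laplace expansion of `∫ exp (n φ)` around a strict maximum point `t` of `φ` over a
neighbourhood `A` of `t`, where `-c` is the first nonvanishing Taylor coefficient. -/
theorem phi_laplace {d : ℕ} (hd : 1 ≤ d) {β : ℝ} (hβ : 0 < β) {h t : ℝ} {ν : ℕ} (hν : 1 ≤ ν)
    {c : ℝ} (hc : 0 < c) (h0 : ∀ q, 1 ≤ q → q < 2 * ν → a d β h t q = 0)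
    (hac : a d β h t (2 * ν) = -c) {A S : Set ℝ} (hA : MeasurableSet A) (hAt : A ∈ 𝓝 t)
    (hS : IsClosed S) (hAS : A ⊆ S) (hmax : ∀ s ∈ S, s ≠ t → phi d β h s < phi d β h t) (K : ℕ) :
    ∃ C, ∀ n : ℕ, 1 ≤ n →
      |(∫ s in A, Real.exp (n * (phi d β h s - phi d β h t))) - ∑ N ∈ Finset.range (K + 1),
        laplaceCoeff ν c (fun m => a d β h t (m + 2 * ν)) N *
          (n : ℝ) ^ (-(((N : ℝ) + 1) / (2 * ν)))| ≤ C * (n : ℝ) ^ (-(((K : ℝ) + 2) / (2 * ν))) := by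
  -- The value at `0` is the limit, in accordance with the Taylor expansion below.
  set u : ℝ → ℝ := fun x =>
    if x = 0 then 0 else (phi d β h (t + x) - phi d β h t) / x ^ (2 * ν) + c with hu
  set b : ℕ → ℝ := fun m => a d β h t (m + 2 * ν) with hb
  have hu1 : (fun x => u x - ∑ m ∈ Finset.range (K + 1), (if m = 0 then 0 else b m) * x ^ m)
      =O[𝓝 0] fun x : ℝ => x ^ (K + 1) := by
    obtain ⟨C, hC⟩ := (phi_taylor d β h t (2 * ν + (K + 1))).bound
    refine IsBigO.of_bound C (hC.mono fun x hx => ?_)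
    rcases eq_or_ne x 0 with rfl | hx0
    · rw [Finset.sum_eq_zero]
      · simp [hu]
      · intro m _
        rcases eq_or_ne m 0 with hm | hm <;> simp [hm]
    · have hxp : 0 < ‖x‖ ^ (2 * ν) := by positivity
      have hlow : ∑ q ∈ Finset.range (2 * ν), a d β h t q * x ^ q = phi d β h t := by
        rw [Finset.sum_eq_single_of_mem 0 (by simp; omega), a_zero, pow_zero, mul_one]
        intro q hq hq0
        rw [h0 q (by omega) (by simpa using hq), zero_mul]
      have hhigh : ∑ m ∈ Finset.range (K + 1), a d β h t (2 * ν + m) * x ^ (2 * ν + m) =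
          x ^ (2 * ν) *
            (∑ m ∈ Finset.range (K + 1), (if m = 0 then 0 else b m) * x ^ m - c) := by
        rw [Finset.sum_range_succ', Finset.sum_range_succ', mul_sub, mul_add, Finset.mul_sum]
        simp only [Nat.add_eq_zero_iff, one_ne_zero, and_false, if_false, if_true, add_zero, hac,
          zero_mul, mul_zero]
        rw [neg_mul, mul_comm c, ← sub_eq_add_neg]
        congr 1
        refine Finset.sum_congr rfl fun m _ => ?_
        rw [hb, add_comm (2 * ν) (m + 1), pow_add]
        ring
      have hkey : phi d β h (t + x) -
          ∑ q ∈ Finset.range (2 * ν + (K + 1)), a d β h t q * x ^ q = x ^ (2 * ν) *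
            (u x - ∑ m ∈ Finset.range (K + 1), (if m = 0 then 0 else b m) * x ^ m) := by
        have hxp' : x ^ (2 * ν) ≠ 0 := pow_ne_zero _ hx0
        rw [Finset.sum_range_add, hlow, hhigh]
        simp only [hu, if_neg hx0]
        field_simp
        ring
      rw [hkey, norm_mul, pow_add, norm_mul, norm_pow, mul_left_comm] at hx
      exact le_of_mul_le_mul_left hx hxp
  set F : ℕ → ℝ → ℝ := fun n x =>
    A.indicator (fun s => Real.exp (n * (phi d β h s - phi d β h t))) (t + x) with hF
  have hFm : ∀ n, Measurable (F n) := by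
    intro n
    have h1 := (continuous_phi d β h).measurable
    have h2 : Measurable fun s => Real.exp (n * (phi d β h s - phi d β h t)) := by fun_prop
    exact (h2.indicator hA).comp (measurable_const_add t)
  have hF0 : ∀ᶠ x in 𝓝 (0 : ℝ), ∀ n : ℕ,
      F n x = Real.exp (n * x ^ (2 * ν) * (-c + u x)) := by
    have h1 : Tendsto (fun x => t + x) (𝓝 0) (𝓝 t) := by
      have : Continuous fun x : ℝ => t + x := by fun_prop
      simpa using this.tendsto 0
    filter_upwards [h1 hAt] with x hx n
    simp only [hF]
    rw [Set.indicator_of_mem (show t + x ∈ A from hx)]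
    congr 1
    rcases eq_or_ne x 0 with rfl | hx0
    · simp [show ν ≠ 0 by omega]
    · have hxp' : x ^ (2 * ν) ≠ 0 := pow_ne_zero _ hx0
      simp only [hu, if_neg hx0]
      field_simp
      ring
  have hF1 : ∀ δ > 0, ∃ L > 0, ∀ (n : ℕ) (x : ℝ), δ ≤ |x| →
      |F n x| ≤ Real.exp (-(L * n) * x ^ 2) := by
    intro δ hδ
    obtain ⟨L, hL, hLb⟩ := exists_phi_sub_le hd hβ hS hmax hδ
    refine ⟨L, hL, fun n x hx => ?_⟩
    simp only [hF]
    by_cases hxA : t + x ∈ A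
    · rw [Set.indicator_of_mem hxA, Real.abs_exp, Real.exp_le_exp]
      have := mul_le_mul_of_nonneg_left (hLb x (hAS hxA) hx) (Nat.cast_nonneg (α := ℝ) n)
      linarith
    · rw [Set.indicator_of_notMem hxA, abs_zero]
      exact (Real.exp_pos _).le
  obtain ⟨C, hC⟩ := laplace_expansion hν hc hu1 hFm hF0 hF1
  refine ⟨C, fun n hn => ?_⟩
  have h1 := hC n hn
  rwa [hF, integral_add_left_eq_self (fun s =>
    A.indicator (fun s => Real.exp (n * (phi d β h s - phi d β h t))) s) t,
    integral_indicator hA] at h1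

theorem sum_range_even {f : ℕ → ℝ} (hf : ∀ N, ¬ Even N → f N = 0) (M : ℕ) :
    ∑ N ∈ Finset.range (2 * M + 1), f N = ∑ p ∈ Finset.range (M + 1), f (2 * p) := by
  induction M with
  | zero => simp
  | succ M ih =>
    rw [Finset.sum_range_succ _ (M + 1), ← ih, show 2 * (M + 1) + 1 = 2 * M + 1 + 1 + 1 by ring,
      Finset.sum_range_succ, Finset.sum_range_succ, hf (2 * M + 1) (by simp), add_zero]
    rfl

theorem laplaceCoeff_two_mul (ν : ℕ) (c : ℝ) (b : ℕ → ℝ) (p : ℕ) :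
    laplaceCoeff ν c b (2 * p) =
      ∑ k ∈ Finset.range (2 * p + 1), compSum b k (2 * p) / k ! * moment ν (2 * ν * k + 2 * p) c :=
  if_pos (even_two_mul p)

/-- The Gaussian moments in terms of double factorials. -/
theorem moment_one_two_mul (j : ℕ) {c : ℝ} (hc : 0 < c) :
    moment 1 (2 * j) c =
      √Real.pi * c ^ (-(1 / 2) : ℝ) * (((2 * j - 1)‼ : ℝ) * (2 * c) ^ (-(j : ℤ))) := by
  have h1 : (((2 * j : ℕ) : ℝ) + 1) / (2 * ((1 : ℕ) : ℝ)) = j + 1 / 2 := by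
    push_cast; ring
  rw [moment, h1, Real.Gamma_nat_add_half, neg_add, Real.rpow_add hc, Real.rpow_neg hc.le j,
    Real.rpow_natCast, zpow_neg, zpow_natCast, mul_pow]
  push_cast
  field_simp

theorem sum_range_compSum_eq_sum_Icc (c : ℕ → ℝ) {N : ℕ} (hN : N ≠ 0) (f : ℕ → ℝ) :
    ∑ k ∈ Finset.range (N + 1), compSum c k N * f k =
      ∑ k ∈ Finset.Icc 1 N, compSum c k N * f k := by
  rw [Finset.range_eq_Ico, Finset.sum_eq_sum_Ico_succ_bot (by omega), compSum_zero, if_neg hN,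
    zero_mul, zero_add]
  rfl

theorem sum_range_compSum_two_mul {c : ℕ → ℝ} (hc : ∀ m, Odd m → c m = 0) {p : ℕ} (hp : p ≠ 0)
    (f : ℕ → ℝ) :
    ∑ k ∈ Finset.range (2 * p + 1), compSum c k (2 * p) * f k =
      ∑ k ∈ Finset.Icc 1 p, compSum (fun m => c (2 * m)) k p * f k := by
  simp_rw [compSum_two_mul hc]
  rw [← sum_range_compSum_eq_sum_Icc _ hp]
  refine (Finset.sum_subset (Finset.range_mono (by omega)) fun k _ hk => ?_).symm
  rw [compSum_eq_zero_of_lt _ (by simpa using hk), zero_mul]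

/-- A single formula for the coefficients at a nondegenerate maximum point: the case `p = 0` of
`eField`, stated through `cosh`, is the term `k = 0`, which vanishes for `p ≠ 0`. -/
theorem eField_eq {d : ℕ} (hd : 1 ≤ d) {β : ℝ} (hβ : 0 < β) {h t : ℝ}
    (ha : a d β h t 2 < 0) (p : ℕ) :
    eField d β h t p = (-(4 * d * β * a d β h t 2)) ^ (-(1 / 2) : ℝ) *
      ∑ k ∈ Finset.range (2 * p + 1), compSum (fun m => a d β h t (m + 2)) k (2 * p) *
        (((2 * (k + p) - 1)‼ : ℝ) / k ! * (2 * -a d β h t 2) ^ (-((k + p : ℕ) : ℤ))) := by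
  have hd' : (0 : ℝ) < d := by exact_mod_cast hd
  rw [eField]
  split_ifs with hp
  · subst hp
    have h1 : -(4 * d * β * a d β h t 2) =
        2 * d * β * (1 / (2 * d * β) - 1 / Real.cosh t ^ 2) := by
      rw [a_two, one_sub_tanh_sq]; ring
    have h2 : 0 < 1 / (2 * d * β) - 1 / Real.cosh t ^ 2 := by
      rw [a_two, one_sub_tanh_sq] at ha
      linarith
    rw [h1, Real.mul_rpow (by positivity) h2.le]
    simp [compSum_zero]
  · rw [sum_range_compSum_eq_sum_Icc _ (by omega)]
    congr 1
    refine Finset.sum_congr rfl fun k _ => ?_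
    rw [show 2 * p + 2 * k = 2 * (k + p) by ring, mul_neg, neg_mul]
    push_cast
    rw [add_comm (p : ℤ)]
    ring

theorem sqrt_mul_laplaceCoeff_one {d : ℕ} (hd : 1 ≤ d) {β : ℝ} (hβ : 0 < β) {h t : ℝ}
    (ha : a d β h t 2 < 0) (p : ℕ) {n : ℕ} (hn : 1 ≤ n) :
    √(n / (4 * Real.pi * d * β)) *
      (laplaceCoeff 1 (-a d β h t 2) (fun m => a d β h t (m + 2 * 1)) (2 * p) *
        (n : ℝ) ^ (-((((2 * p : ℕ) : ℝ) + 1) / (2 * ((1 : ℕ) : ℝ))))) =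
      eField d β h t p * (n : ℝ) ^ (-(p : ℤ)) := by
  have hd' : (0 : ℝ) < d := by exact_mod_cast hd
  have hn' : (0 : ℝ) < n := by exact_mod_cast hn
  have hc : 0 < -a d β h t 2 := by linarith
  have hpi := Real.pi_pos
  have h1 : (n : ℝ) ^ (-((((2 * p : ℕ) : ℝ) + 1) / (2 * ((1 : ℕ) : ℝ)))) =
      (√n)⁻¹ * (n : ℝ) ^ (-(p : ℤ)) := by
    rw [Real.sqrt_eq_rpow, ← Real.rpow_neg hn'.le, ← Real.rpow_intCast, ← Real.rpow_add hn']
    congr 1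
    push_cast; ring
  have h2 : √(n / (4 * Real.pi * d * β)) * (√Real.pi * (-a d β h t 2) ^ (-(1 / 2) : ℝ)) =
      √n * (-(4 * d * β * a d β h t 2)) ^ (-(1 / 2) : ℝ) := by
    rw [show -(4 * d * β * a d β h t 2) = 4 * d * β * -a d β h t 2 by ring,
      Real.mul_rpow (by positivity) hc.le, Real.rpow_neg (by positivity : 0 ≤ 4 * d * β),
      ← Real.sqrt_eq_rpow, Real.sqrt_div hn'.le, show 4 * Real.pi * d * β = Real.pi * (4 * d * β) by
        ring, Real.sqrt_mul hpi.le]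
    have : √Real.pi ≠ 0 := by positivity
    field_simp
  have h3 : laplaceCoeff 1 (-a d β h t 2) (fun m => a d β h t (m + 2 * 1)) (2 * p) =
      √Real.pi * (-a d β h t 2) ^ (-(1 / 2) : ℝ) *
      ∑ k ∈ Finset.range (2 * p + 1), compSum (fun m => a d β h t (m + 2)) k (2 * p) *
        (((2 * (k + p) - 1)‼ : ℝ) / k ! * (2 * -a d β h t 2) ^ (-((k + p : ℕ) : ℤ))) := by
    rw [laplaceCoeff_two_mul, Finset.mul_sum]
    refine Finset.sum_congr rfl fun k _ => ?_
    rw [show 2 * 1 * k + 2 * p = 2 * (k + p) by ring, moment_one_two_mul _ hc]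
    ring
  have hs : √(n : ℝ) ≠ 0 := by positivity
  rw [h3, h1, eField_eq hd hβ ha]
  generalize ∑ k ∈ Finset.range (2 * p + 1), compSum (fun m => a d β h t (m + 2)) k (2 * p) *
    (((2 * (k + p) - 1)‼ : ℝ) / k ! * (2 * -a d β h t 2) ^ (-((k + p : ℕ) : ℤ))) = T
  calc _ = √(n / (4 * Real.pi * d * β)) * (√Real.pi * (-a d β h t 2) ^ (-(1 / 2) : ℝ)) *
        (T * (√n)⁻¹ * (n : ℝ) ^ (-(p : ℤ))) := by ring
    _ = _ := by
      rw [h2]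
      field_simp

/-- The expansion around a nondegenerate maximum point, normalized by the Gaussian prefactor.
Expanding to order `2 * M` in `n ^ (-1 / 2)` leaves a remainder half an order below the last term. -/
theorem quadratic_expansion {d : ℕ} (hd : 1 ≤ d) {β : ℝ} (hβ : 0 < β) {h t : ℝ}
    (ha1 : a d β h t 1 = 0) (ha2 : a d β h t 2 < 0) {A S : Set ℝ} (hA : MeasurableSet A)
    (hAt : A ∈ 𝓝 t) (hS : IsClosed S) (hAS : A ⊆ S)
    (hmax : ∀ s ∈ S, s ≠ t → phi d β h s < phi d β h t) (M : ℕ) :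
    ∃ C, ∀ n : ℕ, 1 ≤ n →
      |√(n / (4 * Real.pi * d * β)) * (∫ s in A, Real.exp (n * (phi d β h s - phi d β h t))) -
        ∑ p ∈ Finset.range (M + 1), eField d β h t p * (n : ℝ) ^ (-(p : ℤ))| ≤
      C * (n : ℝ) ^ (-(M + 1 / 2) : ℝ) := by
  have hd' : (0 : ℝ) < d := by exact_mod_cast hd
  have hpi := Real.pi_pos
  obtain ⟨C, hC⟩ := phi_laplace hd hβ le_rfl (neg_pos.mpr ha2)
    (fun q hq1 hq2 => by rw [show q = 1 by omega, ha1]) (neg_neg _).symm hA hAt hS hAS hmax (2 * M)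
  refine ⟨(√(4 * Real.pi * d * β))⁻¹ * C, fun n hn => ?_⟩
  have hn' : (0 : ℝ) < n := by exact_mod_cast hn
  have h1 := mul_le_mul_of_nonneg_left (hC n hn) (Real.sqrt_nonneg (n / (4 * Real.pi * d * β)))
  rw [← abs_of_nonneg (Real.sqrt_nonneg (n / (4 * Real.pi * d * β))), ← abs_mul,
    abs_of_nonneg (Real.sqrt_nonneg (n / (4 * Real.pi * d * β))), mul_sub, sum_range_even,
    Finset.mul_sum, Finset.sum_congr rfl fun p _ => sqrt_mul_laplaceCoeff_one hd hβ ha2 p hn] at h1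
  · refine h1.trans_eq ?_
    rw [Real.sqrt_div hn'.le, Real.sqrt_eq_rpow (n : ℝ)]
    have h2 : (n : ℝ) ^ (-(M + 1 / 2) : ℝ) = (n : ℝ) ^ (1 / 2 : ℝ) *
        (n : ℝ) ^ (-((((2 * M : ℕ) : ℝ) + 2) / (2 * ((1 : ℕ) : ℝ)))) := by
      rw [← Real.rpow_add hn']
      congr 1
      push_cast; ring
    rw [h2]
    ring
  · intro N hN
    rw [laplaceCoeff, if_neg hN, zero_mul]

theorem sqrt_mul_laplaceCoeff_two {d : ℕ} (p : ℕ) {n : ℕ} (hn : 1 ≤ n) :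
    √(n / (2 * Real.pi)) *
      (laplaceCoeff 2 (1 / 12) (fun m => a d (betaC d) 0 0 (m + 2 * 2)) (2 * p) *
        (n : ℝ) ^ (-((((2 * p : ℕ) : ℝ) + 1) / (2 * ((2 : ℕ) : ℝ))))) =
      eCrit d p * (n : ℝ) ^ (-(p : ℝ) / 2 + 1 / 4) := by
  have hn' : (0 : ℝ) < n := by exact_mod_cast hn
  have hpi := Real.pi_pos
  have h1 : √(n : ℝ) * (n : ℝ) ^ (-((((2 * p : ℕ) : ℝ) + 1) / (2 * ((2 : ℕ) : ℝ)))) =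
      (n : ℝ) ^ (-(p : ℝ) / 2 + 1 / 4) := by
    rw [Real.sqrt_eq_rpow, ← Real.rpow_add hn']
    congr 1
    push_cast; ring
  have h34 : (3 / 4 : ℝ) ^ (1 / 4 : ℝ) = 12 ^ (1 / 4 : ℝ) / 2 := by
    rw [show (3 / 4 : ℝ) = 12 / 2 ^ (4 : ℝ) by norm_num, Real.div_rpow (by norm_num) (by norm_num),
      ← Real.rpow_mul (by norm_num)]
    norm_num
  have hmom : ∀ k : ℕ, moment 2 (2 * 2 * k + 2 * p) (1 / 12) = (3 / 4 : ℝ) ^ (1 / 4 : ℝ) *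
      ((12 : ℝ) ^ ((p : ℝ) / 2 + k) * Real.Gamma ((p : ℝ) / 2 + k + 1 / 4)) := by
    intro k
    have h2 : (((2 * 2 * k + 2 * p : ℕ) : ℝ) + 1) / (2 * ((2 : ℕ) : ℝ)) =
        (p : ℝ) / 2 + k + 1 / 4 := by
      push_cast; ring
    rw [moment, h2, Real.rpow_neg (by norm_num), ← Real.inv_rpow (by norm_num), one_div, inv_inv,
      Real.rpow_add (by norm_num : (0 : ℝ) < 12) _ (1 / 4), h34]
    push_cast
    ring
  have hodd : ∀ m, Odd m → a d (betaC d) 0 0 (m + 2 * 2) = 0 := fun m hm =>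
    a_odd d _ (hm.add_even (by decide))
  have hsum : laplaceCoeff 2 (1 / 12) (fun m => a d (betaC d) 0 0 (m + 2 * 2)) (2 * p) =
      √(2 * Real.pi) * eCrit d p := by
    have h3 : √(2 * Real.pi) ≠ 0 := by positivity
    rw [laplaceCoeff_two_mul, eCrit]
    split_ifs with hp
    · subst hp
      have := hmom 0
      simp only [mul_zero, zero_add, CharP.cast_eq_zero, zero_div, Real.rpow_zero, one_mul] at this
      simp only [mul_zero, zero_add, Finset.sum_range_one, compSum_zero, this]
      field_simp
      simp
    · have h4 : ∀ k, compSum (fun m => a d (betaC d) 0 0 (m + 2 * 2)) k (2 * p) / k ! *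
          moment 2 (2 * 2 * k + 2 * p) (1 / 12) =
          compSum (fun m => a d (betaC d) 0 0 (m + 2 * 2)) k (2 * p) *
            (moment 2 (2 * 2 * k + 2 * p) (1 / 12) / k !) := fun k => by ring
      simp_rw [h4]
      rw [sum_range_compSum_two_mul hodd hp, ← mul_assoc, ← mul_assoc, mul_one_div_cancel h3,
        one_mul, Finset.mul_sum]
      refine Finset.sum_congr rfl fun k _ => ?_
      rw [hmom]
      ring
  rw [hsum, ← h1, Real.sqrt_div hn'.le]
  have h3 : √(2 * Real.pi) ≠ 0 := by positivity
  field_simp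

/-- The expansion around the degenerate maximum point `0` at the critical temperature. -/
theorem critical_expansion {d : ℕ} (hd : 1 ≤ d) (M : ℕ) :
    ∃ C, ∀ n : ℕ, 1 ≤ n →
      |√(n / (2 * Real.pi)) * (∫ s, Real.exp (n * phi d (betaC d) 0 s)) -
        ∑ p ∈ Finset.range (M + 1), eCrit d p * (n : ℝ) ^ (-(p : ℝ) / 2 + 1 / 4)| ≤
      C * (n : ℝ) ^ (-(M : ℝ) / 2) := by
  have hd' : (0 : ℝ) < d := by exact_mod_cast hd
  have hpi := Real.pi_pos
  have hβ : 0 < betaC d := by rw [betaC]; positivity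
  have hβc : 2 * d * betaC d = 1 := by rw [betaC]; field_simp
  have hlow : ∀ q, 1 ≤ q → q < 2 * 2 → a d (betaC d) 0 0 q = 0 := by
    intro q hq1 hq2
    interval_cases q
    · exact a_odd d _ (by decide)
    -- The second derivative vanishes exactly at the critical temperature.
    · rw [a_two, hβc]; simp
    · exact a_odd d _ (by decide)
  obtain ⟨C, hC⟩ := phi_laplace hd hβ one_le_two (c := 1 / 12) (by norm_num) hlow
    (a_four_zero d _) MeasurableSet.univ univ_mem isClosed_univ subset_rfl
    (fun s _ hs => phi_lt_phi_zero hd hβ hβc.le hs) (2 * M)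
  refine ⟨(√(2 * Real.pi))⁻¹ * C, fun n hn => ?_⟩
  have hn' : (0 : ℝ) < n := by exact_mod_cast hn
  have h1 := mul_le_mul_of_nonneg_left (hC n hn) (Real.sqrt_nonneg (n / (2 * Real.pi)))
  have h0 : phi d (betaC d) 0 0 = 0 := by simp [phi]
  rw [← abs_of_nonneg (Real.sqrt_nonneg (n / (2 * Real.pi))), ← abs_mul,
    abs_of_nonneg (Real.sqrt_nonneg (n / (2 * Real.pi))), mul_sub, sum_range_even,
    Finset.mul_sum, Finset.sum_congr rfl fun p _ => sqrt_mul_laplaceCoeff_two p hn,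
    setIntegral_univ] at h1
  · simp only [h0, sub_zero] at h1
    refine h1.trans_eq ?_
    rw [Real.sqrt_div hn'.le, Real.sqrt_eq_rpow (n : ℝ)]
    have h2 : (n : ℝ) ^ (-(M : ℝ) / 2) = (n : ℝ) ^ (1 / 2 : ℝ) *
        (n : ℝ) ^ (-((((2 * M : ℕ) : ℝ) + 2) / (2 * ((2 : ℕ) : ℝ)))) := by
      rw [← Real.rpow_add hn']
      congr 1
      push_cast; ring
    rw [h2]
    ring
  · intro N hN
    rw [laplaceCoeff, if_neg hN, zero_mul]

/-- At high temperature only the even Taylor coefficients contribute. -/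
theorem eHigh_eq_eField {d : ℕ} (hd : 1 ≤ d) {β : ℝ} (hβ : 0 < β) (hβc : 2 * d * β < 1) (p : ℕ) :
    eHigh d β p = eField d β 0 0 p := by
  have hd' : (0 : ℝ) < d := by exact_mod_cast hd
  have hB : 0 < 2 * d * β := by positivity
  have ha : a d β 0 0 2 = -((1 - 2 * d * β) / (2 * d * β)) / 2 := by
    rw [a_two, Real.tanh_zero]; field_simp; ring
  have hpos : 0 < 1 - 2 * d * β := by linarith
  have ha' : a d β 0 0 2 < 0 := by
    have : 0 < (1 - 2 * d * β) / (2 * d * β) := by positivity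
    rw [ha]; linarith
  have h1 : -(4 * d * β * a d β 0 0 2) = 1 - 2 * d * β := by
    rw [ha]; field_simp; ring
  have h2 : 2 * -a d β 0 0 2 = (1 - 2 * d * β) / (2 * d * β) := by
    rw [ha]; ring
  rw [eField_eq hd hβ ha', h1, h2, eHigh]
  split_ifs with hp
  · subst hp
    simp [compSum_zero]
  · rw [sum_range_compSum_two_mul (c := fun m => a d β 0 0 (m + 2))
      (fun m hm => a_odd d β (hm.add_even even_two)) hp, Finset.mul_sum]
    refine Finset.sum_congr rfl fun k _ => ?_
    have h3 : (1 - 2 * d * β) ^ (-((2 * p + 2 * k + 1) / 2) : ℝ) =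
        (1 - 2 * d * β) ^ (-(1 / 2) : ℝ) * ((1 - 2 * d * β) ^ (k + p))⁻¹ := by
      rw [← zpow_natCast, ← zpow_neg, ← Real.rpow_intCast, ← Real.rpow_add hpos]
      congr 1
      push_cast; ring
    have h4 : ∀ m, 2 * (m + 1) = 2 * m + 2 := fun m => by ring
    simp only [h4]
    rw [h3, zpow_neg, zpow_natCast, div_pow, show 2 * p + 2 * k = 2 * (k + p) by ring,
      add_comm p k]
    field_simp

/-- Below the critical temperature the two symmetric maximum points contribute equally. -/
theorem eLow_eq_two_mul_eField {d : ℕ} (hd : 1 ≤ d) {β : ℝ} (hβ : 0 < β) {t : ℝ}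
    (ha : a d β 0 t 2 < 0) (p : ℕ) : eLow d β t p = 2 * eField d β 0 t p := by
  have hd' : (0 : ℝ) < d := by exact_mod_cast hd
  have hdβ : 0 < d * β := by positivity
  rw [eLow, eField]
  split_ifs with hp
  · have h1 : (2 : ℝ) ^ (1 / 2 : ℝ) = 2 * 2 ^ (-(1 / 2) : ℝ) := by
      rw [← Real.rpow_one_add' (by norm_num) (by norm_num)]
      norm_num
    rw [h1, show 2 * d * β = 2 * (d * β) by ring, Real.mul_rpow two_pos.le hdβ.le]
    ring
  · have h1 : (4 : ℝ) ^ (-(1 / 2) : ℝ) = 1 / 2 := by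
      rw [show (4 : ℝ) = 2 ^ (2 : ℝ) by norm_num, ← Real.rpow_mul two_pos.le]
      norm_num [Real.rpow_neg_one]
    have h2 : 0 < -(d * β * a d β 0 t 2) := by nlinarith
    rw [show -(4 * d * β * a d β 0 t 2) = 4 * -(d * β * a d β 0 t 2) by ring,
      Real.mul_rpow (by norm_num) h2.le, h1]
    ring

theorem exists_isLittleO_remainder {X W Y T : ℕ → ℝ} {e e' : ℝ} (he : e < e')
    (hX : ∀ n, 1 ≤ n → X n = W n * Y n)
    (hY : ∃ C, ∀ n : ℕ, 1 ≤ n → |Y n - T n| ≤ C * (n : ℝ) ^ e) :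
    ∃ r : ℕ → ℝ, r =o[atTop] (fun n : ℕ => (n : ℝ) ^ e') ∧
      ∀ n : ℕ, 1 ≤ n → X n = W n * (T n + r n) := by
  obtain ⟨C, hC⟩ := hY
  refine ⟨fun n => Y n - T n, ?_, fun n hn => by rw [hX n hn]; ring⟩
  have h1 : (fun n => Y n - T n) =O[atTop] fun n : ℕ => (n : ℝ) ^ e := by
    refine IsBigO.of_bound C (eventually_atTop.mpr ⟨1, fun n hn => ?_⟩)
    rw [Real.norm_eq_abs, Real.norm_of_nonneg (by positivity)]
    exact hC n hn
  refine h1.trans_isLittleO (isLittleO_of_tendsto' (eventually_atTop.mpr ⟨1, fun n hn h0 => ?_⟩) ?_)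
  · have hn' : (0 : ℝ) < n := by exact_mod_cast hn
    exact absurd h0 (Real.rpow_pos_of_pos hn' _).ne'
  · have h2 := (tendsto_rpow_neg_atTop (sub_pos.mpr he)).comp tendsto_natCast_atTop_atTop
    refine h2.congr' (eventually_atTop.mpr ⟨1, fun n hn => ?_⟩)
    have hn' : (0 : ℝ) < n := by exact_mod_cast hn
    rw [Function.comp_apply, neg_sub, Real.rpow_sub hn']

theorem exists_isLittleO_remainder_zpow {X W Y T : ℕ → ℝ} {M : ℕ}
    (hX : ∀ n, 1 ≤ n → X n = W n * Y n)
    (hY : ∃ C, ∀ n : ℕ, 1 ≤ n → |Y n - T n| ≤ C * (n : ℝ) ^ (-(M + 1 / 2) : ℝ)) :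
    ∃ r : ℕ → ℝ, r =o[atTop] (fun n : ℕ => (n : ℝ) ^ (-(M : ℤ))) ∧
      ∀ n : ℕ, 1 ≤ n → X n = W n * (T n + r n) := by
  have h := exists_isLittleO_remainder (e' := -(M : ℝ)) (by linarith) hX hY
  have hg : (fun n : ℕ => (n : ℝ) ^ (-(M : ℤ))) = fun n : ℕ => (n : ℝ) ^ (-(M : ℝ)) := by
    funext n
    rw [← Real.rpow_intCast]
    push_cast
    rfl
  rwa [hg]

theorem Z_eq_mul_exp_mul_integral {d : ℕ} (hd : 1 ≤ d) {β : ℝ} (hβ : 0 < β) (h t : ℝ) {n : ℕ}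
    (hn : 1 ≤ n) :
    Z d β h n = 2 ^ n * Real.exp (n * phi d β h t) * (√(n / (4 * Real.pi * d * β)) *
      ∫ s, Real.exp (n * (phi d β h s - phi d β h t))) := by
  have h1 : ∀ s, Real.exp (n * phi d β h s) =
      Real.exp (n * phi d β h t) * Real.exp (n * (phi d β h s - phi d β h t)) := by
    intro s
    rw [← Real.exp_add]; ring_nf
  rw [Z_eq_integral hd hβ h hn]
  rw [funext h1, integral_const_mul]
  ring

theorem two_mul_lt_one_of_lt_betaC {d : ℕ} (hd : 1 ≤ d) {β : ℝ} (h : β < betaC d) :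
    2 * d * β < 1 := by
  have hd' : (0 : ℝ) < d := by exact_mod_cast hd
  rw [betaC, lt_div_iff₀ (by positivity)] at h
  linarith

theorem one_lt_two_mul_of_betaC_lt {d : ℕ} (hd : 1 ≤ d) {β : ℝ} (h : betaC d < β) :
    1 < 2 * d * β := by
  have hd' : (0 : ℝ) < d := by exact_mod_cast hd
  rw [betaC, div_lt_iff₀ (by positivity)] at h
  linarith

theorem high_temperature_expansion {d : ℕ} (hd : 1 ≤ d) {β : ℝ} (hβ : 0 ≤ β) (hβc : β < betaC d)
    (M : ℕ) :
    ∃ r : ℕ → ℝ, r =o[atTop] (fun n : ℕ => (n : ℝ) ^ (-(M : ℤ))) ∧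
      ∀ n : ℕ, 1 ≤ n → Z d β 0 n = 2 ^ n * (∑ p ∈ Finset.range (M + 1),
        eHigh d β p * (n : ℝ) ^ (-(p : ℤ)) + r n) := by
  rcases hβ.eq_or_lt with rfl | hβ
  -- Without interaction the partition function is exactly `2 ^ n`.
  · refine ⟨0, isLittleO_zero _ _, fun n _ => ?_⟩
    rw [Z_beta_zero, Finset.sum_eq_single_of_mem 0 (by simp)]
    · simp [eHigh]
    · intro p _ hp
      rw [eHigh, if_neg hp, Finset.sum_eq_zero, zero_mul]
      intro k _
      simp [hp]
  · have hB := two_mul_lt_one_of_lt_betaC hd hβc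
    have hd' : (0 : ℝ) < d := by exact_mod_cast hd
    have ha2 : a d β 0 0 2 < 0 := by
      have : 1 < 1 / (2 * d * β) := by rwa [one_lt_div (by positivity)]
      rw [a_two, Real.tanh_zero]; linarith
    have h0 : phi d β 0 0 = 0 := by simp [phi]
    simp only [eHigh_eq_eField hd hβ hB]
    have hq := quadratic_expansion hd hβ (a_odd d β odd_one) ha2 MeasurableSet.univ univ_mem
      isClosed_univ subset_rfl (fun s _ hs => phi_lt_phi_zero hd hβ hB.le hs) M
    rw [h0] at hq
    refine exists_isLittleO_remainder_zpow
      (fun n hn => by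
        rw [Z_eq_mul_exp_mul_integral hd hβ 0 0 hn, ← setIntegral_univ, h0, mul_zero, Real.exp_zero,
          mul_one])
      hq

theorem critical_temperature_expansion {d : ℕ} (hd : 1 ≤ d) (M : ℕ) :
    ∃ r : ℕ → ℝ, r =o[atTop] (fun n : ℕ => (n : ℝ) ^ (-(M : ℝ) / 2 + 1 / 4)) ∧
      ∀ n : ℕ, 1 ≤ n → Z d (betaC d) 0 n = 2 ^ n * (∑ p ∈ Finset.range (M + 1),
        eCrit d p * (n : ℝ) ^ (-(p : ℝ) / 2 + 1 / 4) + r n) := by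
  have hd' : (0 : ℝ) < d := by exact_mod_cast hd
  have hβ : 0 < betaC d := by rw [betaC]; positivity
  refine exists_isLittleO_remainder (by linarith) (fun n hn => ?_) (critical_expansion hd M)
  rw [Z_eq_integral hd hβ 0 hn]
  congr 4
  rw [betaC]; field_simp; ring

/-- The integral over the positive half-line, doubled by symmetry, sees only the maximum point
`t`. -/
theorem low_temperature_expansion {d : ℕ} (hd : 1 ≤ d) {β : ℝ} (hβ : 0 < β) {t : ℝ} (ht : 0 < t)
    (ha1 : a d β 0 t 1 = 0) (ha2 : a d β 0 t 2 < 0)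
    (hmax : ∀ s, 0 ≤ s → s ≠ t → phi d β 0 s < phi d β 0 t) (M : ℕ) :
    ∃ r : ℕ → ℝ, r =o[atTop] (fun n : ℕ => (n : ℝ) ^ (-(M : ℤ))) ∧
      ∀ n : ℕ, 1 ≤ n → Z d β 0 n = 2 ^ n * Real.exp (n * phi d β 0 t) *
        (∑ p ∈ Finset.range (M + 1), eLow d β t p * (n : ℝ) ^ (-(p : ℤ)) + r n) := by
  obtain ⟨C, hC⟩ := quadratic_expansion hd hβ ha1 ha2 measurableSet_Ioi (Ioi_mem_nhds ht)
    isClosed_Ici Set.Ioi_subset_Ici_self (fun s hs => hmax s hs) M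
  refine exists_isLittleO_remainder_zpow
    (Y := fun n => 2 * (√(n / (4 * Real.pi * d * β)) *
      ∫ s in Set.Ioi 0, Real.exp (n * (phi d β 0 s - phi d β 0 t)))) (fun n hn => ?_)
    ⟨2 * C, fun n hn => ?_⟩
  · have h1 : ∀ s, phi d β 0 s = phi d β 0 |s| := by
      intro s
      rcases abs_choice s with h | h <;> rw [h]
      rw [phi_zero_field_neg]
    have h2 := integral_comp_abs (f := fun s => Real.exp (n * (phi d β 0 s - phi d β 0 t)))
    simp only [← h1] at h2
    rw [Z_eq_mul_exp_mul_integral hd hβ 0 t hn, h2]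
    ring
  · simp_rw [eLow_eq_two_mul_eField hd hβ ha2, mul_assoc (2 : ℝ)]
    rw [← Finset.mul_sum, ← mul_sub, abs_mul, abs_two]
    exact mul_le_mul_of_nonneg_left (hC n hn) two_pos.le

theorem nonzero_field_expansion {d : ℕ} (hd : 1 ≤ d) {β h : ℝ} (hβ : 0 < β) {t : ℝ}
    (ha1 : a d β h t 1 = 0) (ha2 : a d β h t 2 < 0)
    (hmax : ∀ s, s ≠ t → phi d β h s < phi d β h t) (M : ℕ) :
    ∃ r : ℕ → ℝ, r =o[atTop] (fun n : ℕ => (n : ℝ) ^ (-(M : ℤ))) ∧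
      ∀ n : ℕ, 1 ≤ n → Z d β h n = 2 ^ n * Real.exp (n * phi d β h t) *
        (∑ p ∈ Finset.range (M + 1), eField d β h t p * (n : ℝ) ^ (-(p : ℤ)) + r n) :=
  exists_isLittleO_remainder_zpow
    (fun n hn => by rw [Z_eq_mul_exp_mul_integral hd hβ h t hn, ← setIntegral_univ])
    (quadratic_expansion hd hβ ha1 ha2 MeasurableSet.univ univ_mem isClosed_univ
      subset_rfl (fun s _ hs => hmax s hs) M)

end CurieWeiss

theorem theorem1p1 (d : ℕ) (hd : 1 ≤ d) (β h : ℝ) (hβ : 0 ≤ β) :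
    -- high temperature
    (h = 0 → β < CurieWeiss.betaC d → ∀ M : ℕ, 1 ≤ M →
      ∃ r : ℕ → ℝ, r =o[atTop] (fun n : ℕ => (n : ℝ) ^ (-(M : ℤ))) ∧
        ∀ n : ℕ, 1 ≤ n → CurieWeiss.Z d β h n =
          2 ^ n * (∑ p ∈ Finset.range (M + 1),
            CurieWeiss.eHigh d β p * (n : ℝ) ^ (-(p : ℤ)) + r n)) ∧
    -- critical temperature
    (h = 0 → β = CurieWeiss.betaC d → ∀ M : ℕ, 1 ≤ M →
      ∃ r : ℕ → ℝ, r =o[atTop] (fun n : ℕ => (n : ℝ) ^ (-(M : ℝ) / 2 + 1 / 4)) ∧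
        ∀ n : ℕ, 1 ≤ n → CurieWeiss.Z d β h n =
          2 ^ n * (∑ p ∈ Finset.range (M + 1),
            CurieWeiss.eCrit d p * (n : ℝ) ^ (-(p : ℝ) / 2 + 1 / 4) + r n)) ∧
    -- low temperature
    (h = 0 → CurieWeiss.betaC d < β → ∃ z t : ℝ, z = t / (2 * d * β) ∧ 0 < z ∧
      IsGreatest {y : ℝ | Real.tanh (β / CurieWeiss.betaC d * y) = y} z ∧
      ∀ M : ℕ, 1 ≤ M →
      ∃ r : ℕ → ℝ, r =o[atTop] (fun n : ℕ => (n : ℝ) ^ (-(M : ℤ))) ∧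
        ∀ n : ℕ, 1 ≤ n → CurieWeiss.Z d β h n =
          2 ^ n * Real.exp (n * (Real.log (Real.cosh t) - t ^ 2 / (4 * d * β))) *
            (∑ p ∈ Finset.range (M + 1),
              CurieWeiss.eLow d β t p * (n : ℝ) ^ (-(p : ℤ)) + r n)) ∧
    -- nonzero external field
    (h ≠ 0 → 0 < β → ∃ z t : ℝ, z = (t - |h|) / (2 * d * β) ∧ 0 < z ∧
      IsGreatest {y : ℝ | Real.tanh (β / CurieWeiss.betaC d * y + |h|) = y} z ∧
      ∀ M : ℕ, 1 ≤ M →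
      ∃ r : ℕ → ℝ, r =o[atTop] (fun n : ℕ => (n : ℝ) ^ (-(M : ℤ))) ∧
        ∀ n : ℕ, 1 ≤ n → CurieWeiss.Z d β h n =
          2 ^ n * Real.exp (n * (Real.log (Real.cosh t) - (t - |h|) ^ 2 / (4 * d * β))) *
            (∑ p ∈ Finset.range (M + 1),
              CurieWeiss.eField d β h t p * (n : ℝ) ^ (-(p : ℤ)) + r n)) ∧
    -- nonzero external field, degenerate value `β = 0` (the limit of the above: `t_* = |h|`,
    -- leading coefficient `1`, all others `0`, no remainder)
    (h ≠ 0 → β = 0 → ∀ n : ℕ, 1 ≤ n → CurieWeiss.Z d β h n =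
      2 ^ n * Real.exp (n * Real.log (Real.cosh |h|))) := by
  have hBeq : ∀ β : ℝ, β / CurieWeiss.betaC d = 2 * d * β := fun β => by
    rw [CurieWeiss.betaC, div_div_eq_mul_div, div_one, mul_comm]
  refine ⟨?_, ?_, ?_, ?_, ?_⟩
  · rintro rfl hβc M -
    exact CurieWeiss.high_temperature_expansion hd hβ hβc M
  · rintro rfl rfl M -
    exact CurieWeiss.critical_temperature_expansion hd M
  · rintro rfl hβc
    have hB := CurieWeiss.one_lt_two_mul_of_betaC_lt hd hβc
    have hβ0 : 0 < β := by
      rcases hβ.eq_or_lt with rfl | hβ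
      · norm_num at hB
      · exact hβ
    have hd' : (0 : ℝ) < d := by exact_mod_cast hd
    obtain ⟨t, ht, ht0, hneg, hpos, hdd⟩ :=
      CurieWeiss.exists_maximum_point hd (h := 0) hβ0 (Or.inr hB)
    have hgr := CurieWeiss.isGreatest_tanh (by positivity : 0 < 2 * d * β) ht0 hneg
    simp only [abs_zero, sub_zero, add_zero] at hgr
    refine ⟨t / (2 * d * β), t, rfl, by positivity, by rw [hBeq]; exact hgr, fun M _ => ?_⟩
    have := CurieWeiss.low_temperature_expansion hd hβ0 ht (by rw [CurieWeiss.a_one, ht0])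
      (by rw [CurieWeiss.a_two]; linarith)
      (fun s hs hst => CurieWeiss.phi_lt_of_nonneg ht hneg hpos hs hst) M
    simpa only [CurieWeiss.phi, abs_zero, sub_zero] using this
  · intro hh hβ0
    have hd' : (0 : ℝ) < d := by exact_mod_cast hd
    obtain ⟨t, ht, ht0, hneg, hpos, hdd⟩ :=
      CurieWeiss.exists_maximum_point hd (h := h) hβ0 (Or.inl hh)
    have hgr := CurieWeiss.isGreatest_tanh (by positivity : 0 < 2 * d * β) ht0 hneg
    have htanh : 0 < Real.tanh t := by
      rw [Real.tanh_eq_sinh_div_cosh]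
      exact div_pos (Real.sinh_pos_iff.mpr ht) (Real.cosh_pos t)
    refine ⟨(t - |h|) / (2 * d * β), t, rfl, by linarith, by rw [hBeq]; exact hgr, fun M _ => ?_⟩
    refine CurieWeiss.nonzero_field_expansion hd hβ0 (by rw [CurieWeiss.a_one, ht0])
      (by rw [CurieWeiss.a_two]; linarith) (fun s hst => ?_) M
    rcases le_or_gt 0 s with hs | hs
    · exact CurieWeiss.phi_lt_of_nonneg ht hneg hpos hs hst
    -- Reflection to the positive half-line strictly increases `φ`, so `-s = t` is harmless.
    · refine (CurieWeiss.phi_lt_phi_neg hd hβ0 hh hs).trans_le ?_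
      rcases eq_or_ne (-s) t with hst' | hst'
      · rw [hst']
      · exact (CurieWeiss.phi_lt_of_nonneg ht hneg hpos (neg_pos.mpr hs).le hst').le
  · rintro - rfl n -
    exact CurieWeiss.Z_beta_zero d h n
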